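/- **Setting.** Let $n\in\mathbb N_0$. Fix an even function $\chi\in C_0^\infty(\mathbb R)$ with $0\le\chi\le1$, $\chi(r)=1$ for $|r|\le 11/10$ and $\chi(r)=0$ for $|r|\ge 19/10$. For tempered distributions $u$ on $\mathbb R^n$ put $S_ku=\chi(2^{-k}|D_x|)u$ for $k\ge0$, where $D_x=-i\partial_x$, $S_{k}u=0$ for $k<0$, and $\Delta_k u=S_ku-S_{k-1}u$ for $k\ge 0$ (so $\Delta_0=S_0$). For a bounded function $a$ and $m\in\mathbb N_0$, the modified paraproduct is $$T_a^m u=(S_{m-1}a)\,S_{m+2}u+\sum_{k\ge m+3}(S_{k-3}a)\,\Delta_k u ,$$ and $[\Delta_\nu,T_a^m]u=\Delta_\nu(T_a^mu)-T_a^m(\Delta_\nu u)$. For a Lipschitz function $a$ let $\|a\|_{\mathrm{Lip}}=\|\nabla a\|_{L^\infty}$ be its best Lipschitz constant. For $T>0$ let $$\mathcal H=C^0([0,T],L^2(\mathbb R^n))\cap C^0([0,T),H^1(\mathbb R^n))\cap C^1([0,T),L^2(\mathbb R^n)),$$ the functions being complex-valued. **Lemma.** Let $m\in\mathbb N_0$.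 There is a constant $C_m>0$, depending only on $m$ (and on $n$ and $\chi$), such that for every bounded Lipschitz function $a:\mathbb R^n\to\mathbb C$, all $s\in(0,1)$, $\alpha>0$, $T>0$, every $t\in[0,T)$ with $t\le\frac78\,\frac{1-s}{\alpha}$, every $w\in\mathcal H$ and all $j,h\in\{1,\dots,n\}$, $$\sum_{\nu\ge0}2^{-2(s+\alpha t)\nu}\,\big\|\partial_{x_j}[\Delta_\nu,T_a^m]\,\partial_{x_h}w(t,\cdot)\big\|_{L^2}^2\;\le\;\frac{C_m}{1-s}\,\|a\|_{\mathrm{Lip}}^2\sum_{\nu\ge0}2^{2\nu}\|v_\nu(t,\cdot)\|_{L^2}^2,$$ where $v_\nu(t,\cdot)=2^{-(s+\alpha t)\nu}\,\Delta_\nu w(t,\cdot)$. -/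

import Mathlib

open MeasureTheory Set
open scoped SchwartzMap FourierTransform LineDeriv ENNReal NNReal ContDiff

noncomputable section

namespace LittlewoodPaley

/-- The Euclidean space `ℝⁿ`. -/
abbrev Eucl (n : ℕ) : Type := EuclideanSpace ℝ (Fin n)

/-- The even cut-off functions `χ ∈ C_0^∞(ℝ)`, `0 ≤ χ ≤ 1`, equal to `1` for `|r| ≤ 11/10` and
to `0` for `|r| ≥ 19/10`. -/
structure IsCutoff (χ : ℝ → ℝ) : Prop where
  smooth : ContDiff ℝ ∞ χ
  even : ∀ r, χ (-r) = χ r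
  nonneg : ∀ r, 0 ≤ χ r
  le_one : ∀ r, χ r ≤ 1
  eq_one : ∀ r, |r| ≤ 11 / 10 → χ r = 1
  eq_zero : ∀ r, 19 / 10 ≤ |r| → χ r = 0

variable {n : ℕ}

/-- The symbol of `χ_k(D)`, i.e. `χ(2^{-k} |ξ|)` at the frequency `ξ` of `D = -i∂`. Mathlib's Fourier
transform has the phase `exp(-2πi⟨x, η⟩)`, so that `ξ = 2π η` in its frequency variable `η`. -/
def symbol (χ : ℝ → ℝ) (k : ℤ) (η : Eucl n) : ℂ :=
  ((χ ((2 : ℝ) ^ (-k) * (2 * Real.pi * ‖η‖)) : ℝ) : ℂ)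

/-- The operator `S_k = χ_k(D)` on tempered distributions for `k ≥ 0`, and `S_k = 0` for `k < 0`. -/
def lowPass (χ : ℝ → ℝ) (k : ℤ) : 𝓢'(Eucl n, ℂ) →L[ℂ] 𝓢'(Eucl n, ℂ) :=
  if 0 ≤ k then TemperedDistribution.fourierMultiplierCLM ℂ (symbol χ k) else 0

/-- The dyadic block `Δ_k = S_k - S_{k-1}`, `k ≥ 0`; in particular `Δ_0 = S_0`. -/
def block (χ : ℝ → ℝ) (k : ℕ) : 𝓢'(Eucl n, ℂ) →L[ℂ] 𝓢'(Eucl n, ℂ) :=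
  lowPass χ (k : ℤ) - lowPass χ ((k : ℤ) - 1)

/-- The function `S_k a` for a bounded function `a`: for `k ≥ 0` this is `χ_k(D) a`, written as the
convolution of `a` with the kernel `𝓕⁻ χ_k` (a smooth function with bounded derivatives), and
`S_k a = 0` for `k < 0`. -/
def lowPassFun (χ : ℝ → ℝ) (k : ℤ) (a : Eucl n → ℂ) (x : Eucl n) : ℂ :=
  if 0 ≤ k then ∫ y, (𝓕⁻ (symbol χ k : Eucl n → ℂ)) (x - y) * a y else 0

/-- The modified paraproduct
`T_a^m u = S_{m-1}a S_{m+2}u + ∑_{k ≥ m+3} S_{k-3}a Δ_k u` (summation index `k = m + 3 + i`),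
the series converging in the sense of tempered distributions. -/
def paraproduct (χ : ℝ → ℝ) (m : ℕ) (a : Eucl n → ℂ) (u : 𝓢'(Eucl n, ℂ)) : 𝓢'(Eucl n, ℂ) :=
  TemperedDistribution.smulLeftCLM ℂ (lowPassFun χ ((m : ℤ) - 1) a) (lowPass χ ((m : ℤ) + 2) u)
    + ∑' i : ℕ, TemperedDistribution.smulLeftCLM ℂ (lowPassFun χ ((m + i : ℕ) : ℤ) a)
        (block χ (m + 3 + i) u)

/-- The commutator `[Δ_ν, T_a^m] u = Δ_ν (T_a^m u) - T_a^m (Δ_ν u)`. -/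
def commutator (χ : ℝ → ℝ) (ν m : ℕ) (a : Eucl n → ℂ) (u : 𝓢'(Eucl n, ℂ)) : 𝓢'(Eucl n, ℂ) :=
  block χ ν (paraproduct χ m a u) - paraproduct χ m a (block χ ν u)

/-- The partial derivative `∂_{x_j}` of tempered distributions. -/
def partialDeriv (j : Fin n) (u : 𝓢'(Eucl n, ℂ)) : 𝓢'(Eucl n, ℂ) :=
  ∂_{(EuclideanSpace.single j (1 : ℝ) : Eucl n)} u

/-- The `L²` norm of a tempered distribution; it is `∞` if the distribution is not in `L²`. -/
def l2Norm (u : 𝓢'(Eucl n, ℂ)) : ℝ≥0∞ :=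
  ⨅ (g : Lp ℂ 2 (volume : Measure (Eucl n))) (_ : (g : 𝓢'(Eucl n, ℂ)) = u), ‖g‖ₑ

/-- The best Lipschitz constant of `a`, i.e. `‖∇a‖_{L^∞}`. It is at most the full norm
`‖a‖_{L^∞} + ‖∇a‖_{L^∞}`. -/
def lipNorm (a : Eucl n → ℂ) : ℝ≥0 := sInf {K : ℝ≥0 | LipschitzWith K a}

/-- Membership in `C⁰([0,T], L²) ∩ C⁰([0,T), H¹) ∩ C¹([0,T), L²)`. The norm of `H¹` is the `L²` norm
of the Bessel potential of order `1`. -/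
structure MemSolutionSpace (T : ℝ) (w : ℝ → Lp ℂ 2 (volume : Measure (Eucl n))) : Prop where
  continuousOn_L2 : ContinuousOn w (Icc 0 T)
  continuousOn_H1 : ∃ W : ℝ → Lp ℂ 2 (volume : Measure (Eucl n)), ContinuousOn W (Ico 0 T) ∧
    ∀ t ∈ Ico 0 T, TemperedDistribution.besselPotential (Eucl n) ℂ 1 (w t : 𝓢'(Eucl n, ℂ)) =
      (W t : 𝓢'(Eucl n, ℂ))
  contDiffOn_L2 : ContDiffOn ℝ 1 w (Ico 0 T)

end LittlewoodPaley

end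

noncomputable section

namespace LittlewoodPaley

variable {n : ℕ} {χ : ℝ → ℝ}

/-! ### Symbols -/

/-! The estimate is proved by duality, one block at a time. Tested against a Schwartz function φ,
the distribution ∂_j[Δ_ν, T_a^m]∂_h w becomes, up to sign, a sum over k of ∂_h w paired with Δ_k
[b_k, Δ_ν] ∂_j φ, where b_k is the low-frequency part of a that the paraproduct attaches to Δ_k.
Comparing spectra shows that only the k with |k - ν| ≤ m + 5 contribute (`commutator_apply`).

Each remaining term has two factors. Bernstein's inequality bounds ∂_h Δ_k w by a multiple of 2^k
‖Δ_k w‖ (`norm_partialDeriv_mult_block_le`). The operator [b, Δ_ν] ∂_j is bounded on L² by a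
multiple of Lip(b), uniformly in ν (`sNorm_block_commutator_le`): its main part has a kernel
dominated by Lip(b) |t| times the kernel of ∂_j S_ν, and the first moment of the latter does not
depend on ν. Smoothing does not increase Lipschitz constants by more than a fixed factor, so
Lip(b_k) ≲ Lip(a). The Riesz theorem turns the dual bound into an L² bound.

Squaring and summing over ν costs only constants depending on m: windows have bounded length and
overlap, and with σ = s + αt in [0, 1] the weights 2^(-2σν) and 2^(-2σk) are comparable inside a
window. Since 1/(1 - s) ≥ 1, a bound uniform in s suffices.

A preliminary point is that the series defining T_a^m ∂_h w converges as distributions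
(`norm_paraproduct_term_le`, `summable_distribution`); otherwise `∑'` would carry no information. -/

theorem symbol_eq_one (hχ : IsCutoff χ) {k : ℤ} {η : Eucl n}
    (h : 2 * Real.pi * ‖η‖ ≤ 11 / 10 * 2 ^ k) : symbol χ k η = 1 := by
  unfold symbol
  rw [hχ.eq_one, Complex.ofReal_one]
  rw [abs_of_nonneg (by positivity), zpow_neg, inv_mul_le_iff₀ (by positivity)]
  linarith

theorem symbol_eq_zero (hχ : IsCutoff χ) {k : ℤ} {η : Eucl n}
    (h : 19 / 10 * 2 ^ k ≤ 2 * Real.pi * ‖η‖) : symbol χ k η = 0 := by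
  unfold symbol
  rw [hχ.eq_zero, Complex.ofReal_zero]
  rw [abs_of_nonneg (by positivity), zpow_neg, le_inv_mul_iff₀ (by positivity)]
  linarith

theorem symbol_neg (k : ℤ) (η : Eucl n) : symbol χ k (-η) = symbol χ k η := by
  simp [symbol]

theorem symbol_eq_symbol_zero (k : ℤ) (η : Eucl n) :
    symbol χ k η = symbol χ 0 (((2 : ℝ) ^ k)⁻¹ • η) := by
  simp only [symbol, norm_smul, norm_inv, norm_zpow, Real.norm_ofNat, zpow_neg, zpow_zero,
    inv_one, one_mul]
  congr 2
  ring

theorem norm_symbol_sub_le (hχ : IsCutoff χ) (k l : ℤ) (η : Eucl n) :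
    ‖symbol χ k η - symbol χ l η‖ ≤ 1 := by
  simp only [symbol, ← Complex.ofReal_sub, Complex.norm_real, Real.norm_eq_abs]
  rw [abs_le]
  constructor <;>
  linarith [hχ.nonneg (2 ^ (-k) * (2 * Real.pi * ‖η‖)), hχ.nonneg (2 ^ (-l) * (2 * Real.pi * ‖η‖)),
    hχ.le_one (2 ^ (-k) * (2 * Real.pi * ‖η‖)), hχ.le_one (2 ^ (-l) * (2 * Real.pi * ‖η‖))]

theorem norm_symbol_le (hχ : IsCutoff χ) (k : ℤ) (η : Eucl n) : ‖symbol χ k η‖ ≤ 1 := by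
  simp only [symbol, Complex.norm_real, Real.norm_eq_abs]
  rw [abs_of_nonneg (hχ.nonneg _)]
  exact hχ.le_one _

theorem norm_one_sub_symbol_le (hχ : IsCutoff χ) (k : ℤ) (η : Eucl n) :
    ‖1 - symbol χ k η‖ ≤ 1 := by
  simp only [symbol, ← Complex.ofReal_one, ← Complex.ofReal_sub, Complex.norm_real,
    Real.norm_eq_abs]
  rw [abs_of_nonneg (sub_nonneg.2 (hχ.le_one _))]
  linarith [hχ.nonneg (2 ^ (-k) * (2 * Real.pi * ‖η‖))]

/-- The norm is not smooth at the origin, but the symbol is constant there. -/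
theorem contDiff_symbol (hχ : IsCutoff χ) (k : ℤ) :
    ContDiff ℝ ∞ (symbol χ k : Eucl n → ℂ) := by
  rw [contDiff_iff_contDiffAt]
  intro η
  rcases eq_or_ne η 0 with rfl | hη
  · have hc : ContinuousAt (fun η : Eucl n => 2 * Real.pi * ‖η‖) 0 := by fun_prop
    have h0 : 2 * Real.pi * ‖(0 : Eucl n)‖ < 11 / 10 * 2 ^ k := by
      rw [norm_zero, mul_zero]
      positivity
    have : (symbol χ k : Eucl n → ℂ) =ᶠ[nhds 0] fun _ => 1 := by
      filter_upwards [hc.eventually_lt_const h0] with η h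
      exact symbol_eq_one hχ h.le
    exact contDiffAt_const.congr_of_eventuallyEq this
  · have h1 : ContDiffAt ℝ ∞ (fun η : Eucl n => ‖η‖) η := contDiffAt_norm ℝ hη
    have h2 : ContDiffAt ℝ ∞ (fun η : Eucl n => (2 : ℝ) ^ (-k) * (2 * Real.pi * ‖η‖)) η :=
      contDiffAt_const.mul (contDiffAt_const.mul h1)
    exact Complex.ofRealCLM.contDiff.contDiffAt.comp η (hχ.smooth.contDiffAt.comp η h2)

theorem hasCompactSupport_symbol (hχ : IsCutoff χ) (k : ℤ) :
    HasCompactSupport (symbol χ k : Eucl n → ℂ) := by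
  refine HasCompactSupport.of_support_subset_isCompact
    (isCompact_closedBall (0 : Eucl n) (19 / 10 * 2 ^ k)) fun η hη => ?_
  rw [Metric.mem_closedBall, dist_zero_right]
  by_contra! h
  refine hη (symbol_eq_zero hχ ?_)
  nlinarith [Real.pi_gt_three, norm_nonneg η]

/-- The symbol `χ_k` as a Schwartz function. -/
def symbolS (hχ : IsCutoff χ) (k : ℤ) : 𝓢(Eucl n, ℂ) :=
  (hasCompactSupport_symbol hχ k).toSchwartzMap (contDiff_symbol hχ k)

@[simp]
theorem symbolS_apply (hχ : IsCutoff χ) (k : ℤ) (η : Eucl n) :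
    symbolS hχ k η = symbol χ k η := rfl

@[fun_prop]
theorem symbol_hasTemperateGrowth (hχ : IsCutoff χ) (k : ℤ) :
    (symbol χ k : Eucl n → ℂ).HasTemperateGrowth :=
  (hasCompactSupport_symbol hχ k).hasTemperateGrowth (contDiff_symbol hχ k)

/-- The symbol of `S_k`, extended by zero to negative `k`. -/
def lowSymbol (χ : ℝ → ℝ) (k : ℤ) (η : Eucl n) : ℂ := if 0 ≤ k then symbol χ k η else 0

theorem lowSymbol_of_nonneg {k : ℤ} (hk : 0 ≤ k) :
    (lowSymbol χ k : Eucl n → ℂ) = symbol χ k := by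
  ext η
  simp [lowSymbol, hk]

theorem lowSymbol_of_neg {k : ℤ} (hk : k < 0) : (lowSymbol χ k : Eucl n → ℂ) = fun _ => 0 := by
  ext η
  simp [lowSymbol, hk]

theorem lowSymbol_eq_zero (hχ : IsCutoff χ) {k : ℤ} {η : Eucl n}
    (h : 19 / 10 * 2 ^ k ≤ 2 * Real.pi * ‖η‖) : lowSymbol χ k η = 0 := by
  simp [lowSymbol, symbol_eq_zero hχ h]

@[fun_prop]
theorem lowSymbol_hasTemperateGrowth (hχ : IsCutoff χ) (k : ℤ) :
    (lowSymbol χ k : Eucl n → ℂ).HasTemperateGrowth := by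
  rcases le_or_gt 0 k with hk | hk
  · rw [lowSymbol_of_nonneg hk]
    exact symbol_hasTemperateGrowth hχ k
  · rw [lowSymbol_of_neg hk]
    exact .zero

/-- The symbol of the dyadic block `Δ_k`. -/
def blockSymbol (χ : ℝ → ℝ) (k : ℕ) (η : Eucl n) : ℂ :=
  lowSymbol χ (k : ℤ) η - lowSymbol χ ((k : ℤ) - 1) η

@[fun_prop]
theorem blockSymbol_hasTemperateGrowth (hχ : IsCutoff χ) (k : ℕ) :
    (blockSymbol χ k : Eucl n → ℂ).HasTemperateGrowth :=
  (lowSymbol_hasTemperateGrowth hχ k).sub (lowSymbol_hasTemperateGrowth hχ (k - 1))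

theorem norm_blockSymbol_le (hχ : IsCutoff χ) (k : ℕ) (η : Eucl n) : ‖blockSymbol χ k η‖ ≤ 1 := by
  rcases Nat.eq_zero_or_pos k with rfl | hk
  · simpa [blockSymbol, lowSymbol] using norm_symbol_le hχ 0 η
  · have h1 : (0 : ℤ) ≤ (k : ℤ) - 1 := by omega
    rw [blockSymbol, lowSymbol_of_nonneg h1, lowSymbol_of_nonneg (by omega)]
    exact norm_symbol_sub_le hχ _ _ _

theorem blockSymbol_eq_zero_of_le (hχ : IsCutoff χ) {k : ℕ} {η : Eucl n}
    (h : 19 / 10 * 2 ^ k ≤ 2 * Real.pi * ‖η‖) : blockSymbol χ k η = 0 := by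
  have h1 : (19 / 10 : ℝ) * 2 ^ ((k : ℤ) - 1) ≤ 19 / 10 * 2 ^ k := by
    rw [zpow_sub₀ two_ne_zero, zpow_natCast, zpow_one]
    have : (0 : ℝ) < 2 ^ k := by positivity
    linarith
  rw [blockSymbol, lowSymbol_eq_zero hχ (by simpa using h), lowSymbol_eq_zero hχ (h1.trans h),
    sub_zero]

theorem blockSymbol_eq_zero_of_ge (hχ : IsCutoff χ) {k : ℕ} (hk : k ≠ 0) {η : Eucl n}
    (h : 2 * Real.pi * ‖η‖ ≤ 11 / 20 * 2 ^ k) : blockSymbol χ k η = 0 := by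
  have h0 : (11 / 10 : ℝ) * 2 ^ ((k : ℤ) - 1) = 11 / 20 * 2 ^ k := by
    rw [zpow_sub₀ two_ne_zero, zpow_natCast, zpow_one]
    ring
  have h1 : (0 : ℤ) ≤ (k : ℤ) - 1 := by omega
  have : (0 : ℝ) < 2 ^ k := by positivity
  rw [blockSymbol, lowSymbol_of_nonneg h1, lowSymbol_of_nonneg (by omega),
    symbol_eq_one hχ (by rw [zpow_natCast]; linarith), symbol_eq_one hχ (by rw [h0]; exact h),
    sub_self]

theorem sum_blockSymbol (N : ℕ) (η : Eucl n) :
    ∑ k ∈ Finset.range (N + 1), blockSymbol χ k η = symbol χ N η := by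
  induction N with
  | zero => simp [blockSymbol, lowSymbol]
  | succ N ih =>
    rw [Finset.sum_range_succ, ih, blockSymbol, lowSymbol_of_nonneg (by positivity),
      lowSymbol_of_nonneg (by simp)]
    simp

/-- The support of the block ends at 1.9 · 2^k, inside the plateau of the next cut-off, which
reaches 2.2 · 2^k. This inserts a band-limiting factor for Bernstein's inequality. -/
theorem blockSymbol_mul_symbol (hχ : IsCutoff χ) (k : ℕ) (η : Eucl n) :
    blockSymbol χ k η * symbol χ (k + 1) η = blockSymbol χ k η := by
  rcases le_or_gt (19 / 10 * 2 ^ k) (2 * Real.pi * ‖η‖) with h | h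
  · rw [blockSymbol_eq_zero_of_le hχ h, zero_mul]
  · rw [symbol_eq_one hχ, mul_one]
    rw [zpow_add₀ two_ne_zero, zpow_natCast, zpow_one]
    have : (0 : ℝ) < 2 ^ k := by positivity
    linarith

/-! ### Fourier multipliers -/

/-- Fourier multipliers on complex-valued Schwartz functions. -/
abbrev mult (g : Eucl n → ℂ) : 𝓢(Eucl n, ℂ) →L[ℂ] 𝓢(Eucl n, ℂ) :=
  SchwartzMap.fourierMultiplierCLM ℂ g

theorem fourier_mult {g : Eucl n → ℂ} (hg : g.HasTemperateGrowth) (φ : 𝓢(Eucl n, ℂ))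
    (ξ : Eucl n) : 𝓕 (mult g φ) ξ = g ξ * 𝓕 φ ξ := by
  rw [SchwartzMap.fourierMultiplierCLM_apply, FourierTransform.fourier_fourierInv_eq,
    SchwartzMap.smulLeftCLM_apply_apply hg, smul_eq_mul]

theorem schwartz_ext_fourier {φ ψ : 𝓢(Eucl n, ℂ)} (h : ∀ ξ, 𝓕 φ ξ = 𝓕 ψ ξ) : φ = ψ := by
  have h' : 𝓕 φ = 𝓕 ψ := SchwartzMap.ext h
  calc φ = 𝓕⁻ (𝓕 φ) := by simp
    _ = 𝓕⁻ (𝓕 ψ) := by rw [h']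
    _ = ψ := by simp

theorem schwartz_fourier_sub (φ ψ : 𝓢(Eucl n, ℂ)) : 𝓕 (φ - ψ) = 𝓕 φ - 𝓕 ψ :=
  map_sub (FourierTransform.fourierCLM ℂ 𝓢(Eucl n, ℂ)) φ ψ

theorem mult_mult {g g' : Eucl n → ℂ} (hg : g.HasTemperateGrowth) (hg' : g'.HasTemperateGrowth)
    (φ : 𝓢(Eucl n, ℂ)) : mult g (mult g' φ) = mult (fun ξ => g ξ * g' ξ) φ :=
  SchwartzMap.fourierMultiplierCLM_fourierMultiplierCLM_apply hg hg' φ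

theorem mult_comm {g g' : Eucl n → ℂ} (hg : g.HasTemperateGrowth) (hg' : g'.HasTemperateGrowth)
    (φ : 𝓢(Eucl n, ℂ)) : mult g (mult g' φ) = mult g' (mult g φ) := by
  rw [mult_mult hg hg', mult_mult hg' hg]
  simp_rw [mul_comm]

/-- The `j`-th standard basis vector. -/
abbrev basisVec (j : Fin n) : Eucl n := EuclideanSpace.single j (1 : ℝ)

/-- The symbol of `∂_{x_j}`. -/
def derivSymbol (j : Fin n) (ξ : Eucl n) : ℂ :=
  (2 * Real.pi * Complex.I) * ((inner ℝ ξ (basisVec j) : ℝ) : ℂ)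

@[fun_prop]
theorem derivSymbol_hasTemperateGrowth (j : Fin n) :
    (derivSymbol j : Eucl n → ℂ).HasTemperateGrowth := by
  unfold derivSymbol
  fun_prop

theorem norm_derivSymbol_le (j : Fin n) (ξ : Eucl n) :
    ‖derivSymbol j ξ‖ ≤ 2 * Real.pi * ‖ξ‖ := by
  rw [derivSymbol, norm_mul, Complex.norm_real]
  have h1 : ‖(2 * Real.pi * Complex.I : ℂ)‖ = 2 * Real.pi := by
    simp [abs_of_pos Real.pi_pos]
  rw [h1]
  gcongr
  simpa using norm_inner_le_norm (𝕜 := ℝ) ξ (basisVec j)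

theorem lineDeriv_eq_mult (j : Fin n) (φ : 𝓢(Eucl n, ℂ)) :
    ∂_{basisVec j} φ = mult (derivSymbol j) φ := by
  rw [SchwartzMap.lineDeriv_eq_fourierMultiplierCLM,
    ← SchwartzMap.fourierMultiplierCLM_ofReal ℂ (by fun_prop)]
  have : (derivSymbol j : Eucl n → ℂ) = (2 * Real.pi * Complex.I : ℂ) •
      fun ξ : Eucl n => ((inner ℝ ξ (basisVec j) : ℝ) : ℂ) := rfl
  rw [this, mult, SchwartzMap.fourierMultiplierCLM_smul (by fun_prop)]
  rfl

/-- The transpose of the multiplier with symbol g(ξ) has symbol g(-ξ), so even symbols pass from a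
distribution to its test function unchanged. -/
theorem fourier_smul_fourierInv_eq_mult {g : Eucl n → ℂ} (hg : g.HasTemperateGrowth)
    (he : ∀ ξ, g (-ξ) = g ξ) (φ : 𝓢(Eucl n, ℂ)) :
    𝓕 (SchwartzMap.smulLeftCLM ℂ g (𝓕⁻ φ)) = mult g φ := by
  ext x
  rw [SchwartzMap.fourierMultiplierCLM_apply, SchwartzMap.fourierInv_coe, SchwartzMap.fourier_coe,
    Real.fourierInv_eq_fourier_comp_neg]
  refine congrArg (fun f : Eucl n → ℂ => 𝓕 f x) (funext fun ξ => ?_)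
  rw [SchwartzMap.smulLeftCLM_apply_apply hg, SchwartzMap.smulLeftCLM_apply_apply hg, he,
    SchwartzMap.fourierInv_coe, Real.fourierInv_eq_fourier_neg, SchwartzMap.fourier_coe]

theorem lowPass_apply (hχ : IsCutoff χ) (k : ℤ) (u : 𝓢'(Eucl n, ℂ)) (φ : 𝓢(Eucl n, ℂ)) :
    lowPass χ k u φ = u (mult (lowSymbol χ k) φ) := by
  rcases le_or_gt 0 k with hk | hk
  · rw [lowPass, if_pos hk, TemperedDistribution.fourierMultiplierCLM_apply_apply,
      fourier_smul_fourierInv_eq_mult (by fun_prop (disch := assumption)) (symbol_neg k),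
      lowSymbol_of_nonneg hk]
  · rw [lowPass, if_neg hk.not_ge, lowSymbol_of_neg hk, mult,
      SchwartzMap.fourierMultiplierCLM_const]
    simp

theorem mult_blockSymbol (hχ : IsCutoff χ) (k : ℕ) (φ : 𝓢(Eucl n, ℂ)) :
    mult (blockSymbol χ k) φ = mult (lowSymbol χ k) φ - mult (lowSymbol χ ((k : ℤ) - 1)) φ := by
  apply schwartz_ext_fourier
  intro ξ
  rw [fourier_mult (blockSymbol_hasTemperateGrowth hχ k), schwartz_fourier_sub,
    sub_apply]
  rw [fourier_mult (lowSymbol_hasTemperateGrowth hχ _),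
    fourier_mult (lowSymbol_hasTemperateGrowth hχ _), blockSymbol, sub_mul]

theorem block_apply (hχ : IsCutoff χ) (k : ℕ) (u : 𝓢'(Eucl n, ℂ)) (φ : 𝓢(Eucl n, ℂ)) :
    block χ k u φ = u (mult (blockSymbol χ k) φ) := by
  rw [mult_blockSymbol hχ, map_sub, ← lowPass_apply hχ, ← lowPass_apply hχ, block]
  rfl

theorem partialDeriv_apply (j : Fin n) (u : 𝓢'(Eucl n, ℂ)) (φ : 𝓢(Eucl n, ℂ)) :
    partialDeriv j u φ = -u (mult (derivSymbol j) φ) := by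
  rw [partialDeriv, TemperedDistribution.lineDerivOp_apply_apply, map_neg, lineDeriv_eq_mult]

/-! ### The `L²` norm -/

/-- The `L²` norm of a Schwartz function. -/
abbrev sNorm (φ : 𝓢(Eucl n, ℂ)) : ℝ := ‖φ.toLp 2 (volume : Measure (Eucl n))‖

theorem sNorm_zero : sNorm (0 : 𝓢(Eucl n, ℂ)) = 0 := by
  have h0 : (0 : 𝓢(Eucl n, ℂ)).toLp 2 (volume : Measure (Eucl n)) = 0 :=
    map_zero (SchwartzMap.toLpCLM ℂ ℂ 2 (volume : Measure (Eucl n)))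
  rw [sNorm, h0, norm_zero]

theorem sNorm_add_le (φ ψ : 𝓢(Eucl n, ℂ)) : sNorm (φ + ψ) ≤ sNorm φ + sNorm ψ := by
  have : (φ + ψ).toLp 2 (volume : Measure (Eucl n)) = φ.toLp 2 volume + ψ.toLp 2 volume :=
    map_add (SchwartzMap.toLpCLM ℂ ℂ 2 (volume : Measure (Eucl n))) φ ψ
  rw [sNorm, this]
  exact norm_add_le _ _

theorem sNorm_sub_le (φ ψ : 𝓢(Eucl n, ℂ)) : sNorm (φ - ψ) ≤ sNorm φ + sNorm ψ := by
  have : (φ - ψ).toLp 2 (volume : Measure (Eucl n)) = φ.toLp 2 volume - ψ.toLp 2 volume :=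
    map_sub (SchwartzMap.toLpCLM ℂ ℂ 2 (volume : Measure (Eucl n))) φ ψ
  rw [sNorm, this]
  exact norm_sub_le _ _

theorem sNorm_le_of_pointwise {φ ψ : 𝓢(Eucl n, ℂ)} {C : ℝ}
    (h : ∀ x, ‖φ x‖ ≤ C * ‖ψ x‖) : sNorm φ ≤ C * sNorm ψ := by
  apply Lp.norm_le_mul_norm_of_ae_le_mul
  filter_upwards [φ.coeFn_toLp 2 volume, ψ.coeFn_toLp 2 volume] with x h1 h2
  rw [h1, h2]
  exact h x

theorem sNorm_mult_le {g g' : Eucl n → ℂ} (hg : g.HasTemperateGrowth)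
    (hg' : g'.HasTemperateGrowth) {C : ℝ} (h : ∀ ξ, ‖g ξ‖ ≤ C * ‖g' ξ‖) (φ : 𝓢(Eucl n, ℂ)) :
    sNorm (mult g φ) ≤ C * sNorm (mult g' φ) := by
  rw [sNorm, sNorm, ← SchwartzMap.norm_fourier_toL2_eq, ← SchwartzMap.norm_fourier_toL2_eq (mult g' φ)]
  apply sNorm_le_of_pointwise
  intro ξ
  rw [fourier_mult hg, fourier_mult hg', norm_mul, norm_mul, ← mul_assoc]
  gcongr
  exact h ξ

theorem mult_one (φ : 𝓢(Eucl n, ℂ)) : mult (fun _ => 1) φ = φ := by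
  rw [mult, SchwartzMap.fourierMultiplierCLM_const, one_smul]
  rfl

theorem norm_star_Lp (w : Lp ℂ 2 (volume : Measure (Eucl n))) : ‖star w‖ = ‖w‖ := by
  refine le_antisymm (Lp.norm_le_norm_of_ae_le ?_) (Lp.norm_le_norm_of_ae_le ?_) <;>
  filter_upwards [Lp.coeFn_star w] with x hx <;>
  simp [hx]

theorem sNorm_mult_le' {g : Eucl n → ℂ} (hg : g.HasTemperateGrowth) {C : ℝ}
    (h : ∀ ξ, ‖g ξ‖ ≤ C) (φ : 𝓢(Eucl n, ℂ)) : sNorm (mult g φ) ≤ C * sNorm φ := by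
  have := sNorm_mult_le hg (g' := fun _ => 1) (by fun_prop) (C := C) (by simpa using h) φ
  rwa [mult_one] at this

/-- The distributional pairing is bilinear, so conjugating w turns it into an inner product and
Cauchy–Schwarz applies. -/
theorem norm_L2_apply_le (w : Lp ℂ 2 (volume : Measure (Eucl n))) (φ : 𝓢(Eucl n, ℂ)) :
    ‖(w : 𝓢'(Eucl n, ℂ)) φ‖ ≤ ‖w‖ * sNorm φ := by
  have h : (w : 𝓢'(Eucl n, ℂ)) φ = inner ℂ (star w) (φ.toLp 2 volume) := by
    rw [Lp.toTemperedDistribution_apply, L2.inner_def]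
    apply integral_congr_ae
    filter_upwards [φ.coeFn_toLp 2 volume, Lp.coeFn_star w] with x h1 h2
    rw [h1, h2]
    simp
  rw [h]
  refine (norm_inner_le_norm _ _).trans_eq ?_
  rw [norm_star_Lp]

/-- Riesz representation. The functional lives on the image of the Schwartz space in L²; a
norm-preserving Hahn–Banach extension makes a density argument unnecessary. -/
theorem exists_L2_of_bound (u : 𝓢'(Eucl n, ℂ)) {C : ℝ} (hC : 0 ≤ C)
    (h : ∀ φ, ‖u φ‖ ≤ C * sNorm φ) :
    ∃ w : Lp ℂ 2 (volume : Measure (Eucl n)), (w : 𝓢'(Eucl n, ℂ)) = u ∧ ‖w‖ ≤ C := by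
  let ι : 𝓢(Eucl n, ℂ) →ₗ[ℂ] Lp ℂ 2 (volume : Measure (Eucl n)) :=
    (SchwartzMap.toLpCLM ℂ ℂ 2 (volume : Measure (Eucl n)) : _ →L[ℂ] _)
  have hι : Function.Injective ι := SchwartzMap.injective_toLp 2 volume
  let e := LinearEquiv.ofInjective ι hι
  let ul : 𝓢(Eucl n, ℂ) →ₗ[ℂ] ℂ :=
    { toFun := fun φ => u φ
      map_add' := fun φ ψ => map_add u φ ψ
      map_smul' := fun c φ => map_smul u c φ }
  let f : LinearMap.range ι →L[ℂ] ℂ := (ul ∘ₗ e.symm.toLinearMap).mkContinuous C (by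
    intro x
    obtain ⟨φ, rfl⟩ := e.surjective x
    change ‖u (e.symm (e φ))‖ ≤ C * sNorm φ
    rw [LinearEquiv.symm_apply_apply]
    exact h φ)
  have hf : ‖f‖ ≤ C := LinearMap.mkContinuous_norm_le _ hC _
  obtain ⟨F, hF, hFn⟩ := exists_extension_norm_eq (LinearMap.range ι) f
  let y := (InnerProductSpace.toDual ℂ (Lp ℂ 2 (volume : Measure (Eucl n)))).symm F
  have hy : ‖y‖ ≤ C := by
    rw [LinearIsometryEquiv.norm_map, hFn]
    exact hf
  refine ⟨star y, ?_, by rwa [norm_star_Lp]⟩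
  ext φ
  have h1 : F (φ.toLp 2 volume) = u φ := by
    have := hF (e φ)
    have h3 : f (e φ) = u φ := by
      change u (e.symm (e φ)) = u φ
      rw [LinearEquiv.symm_apply_apply]
    rw [h3] at this
    exact this
  rw [← h1, ← InnerProductSpace.toDual_symm_apply (x := φ.toLp 2 volume),
    Lp.toTemperedDistribution_apply, L2.inner_def]
  apply integral_congr_ae
  filter_upwards [φ.coeFn_toLp 2 volume, Lp.coeFn_star y] with x h1 h2
  rw [h1, h2]
  simp [y]

theorem toTemperedDistribution_injective {v w : Lp ℂ 2 (volume : Measure (Eucl n))}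
    (h : (v : 𝓢'(Eucl n, ℂ)) = w) : v = w := by
  have hk := Lp.ker_toTemperedDistributionCLM_eq_bot (F := ℂ) (μ := (volume : Measure (Eucl n)))
    (p := 2)
  exact LinearMap.ker_eq_bot.1 hk h

theorem l2Norm_eq (w : Lp ℂ 2 (volume : Measure (Eucl n))) :
    l2Norm (w : 𝓢'(Eucl n, ℂ)) = ‖w‖ₑ := by
  unfold l2Norm
  refine le_antisymm (iInf_le_of_le w (iInf_le _ rfl)) (le_iInf₂ fun g hg => ?_)
  rw [toTemperedDistribution_injective hg]

theorem l2Norm_le_of_bound (u : 𝓢'(Eucl n, ℂ)) {C : ℝ} (hC : 0 ≤ C)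
    (h : ∀ φ, ‖u φ‖ ≤ C * sNorm φ) : l2Norm u ≤ ENNReal.ofReal C := by
  obtain ⟨w, rfl, hw⟩ := exists_L2_of_bound u hC h
  rw [l2Norm_eq, ← ofReal_norm]
  exact ENNReal.ofReal_le_ofReal hw

/-! ### Dyadic blocks as L² functions, and Bernstein's inequality. -/

theorem exists_L2_block (hχ : IsCutoff χ) (k : ℕ) (w : Lp ℂ 2 (volume : Measure (Eucl n))) :
    ∃ v : Lp ℂ 2 (volume : Measure (Eucl n)),
      (v : 𝓢'(Eucl n, ℂ)) = block χ k (w : 𝓢'(Eucl n, ℂ)) ∧ ‖v‖ ≤ ‖w‖ :=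
  exists_L2_of_bound (block χ k (w : 𝓢'(Eucl n, ℂ))) (norm_nonneg w)
    fun φ => by
      rw [block_apply hχ]
      refine (norm_L2_apply_le w _).trans ?_
      have := sNorm_mult_le' (blockSymbol_hasTemperateGrowth hχ k) (norm_blockSymbol_le hχ k) φ
      rw [one_mul] at this
      gcongr

/-- The dyadic block of an `L²` function. -/
def blockL2 (hχ : IsCutoff χ) (k : ℕ) (w : Lp ℂ 2 (volume : Measure (Eucl n))) :
    Lp ℂ 2 (volume : Measure (Eucl n)) :=
  (exists_L2_block hχ k w).choose

theorem coe_blockL2 (hχ : IsCutoff χ) (k : ℕ) (w : Lp ℂ 2 (volume : Measure (Eucl n))) :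
    (blockL2 hχ k w : 𝓢'(Eucl n, ℂ)) = block χ k (w : 𝓢'(Eucl n, ℂ)) :=
  (exists_L2_block hχ k w).choose_spec.1

theorem norm_blockL2_le (hχ : IsCutoff χ) (k : ℕ) (w : Lp ℂ 2 (volume : Measure (Eucl n))) :
    ‖blockL2 hχ k w‖ ≤ ‖w‖ :=
  (exists_L2_block hχ k w).choose_spec.2

theorem l2Norm_smul_block (hχ : IsCutoff χ) (k : ℕ) (w : Lp ℂ 2 (volume : Measure (Eucl n)))
    {c : ℝ} (hc : 0 ≤ c) :
    l2Norm ((c : ℂ) • block χ k (w : 𝓢'(Eucl n, ℂ))) =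
      ENNReal.ofReal (c * ‖blockL2 hχ k w‖) := by
  have : (c : ℂ) • block χ k (w : 𝓢'(Eucl n, ℂ)) =
      (((c : ℂ) • blockL2 hχ k w : Lp ℂ 2 (volume : Measure (Eucl n))) : 𝓢'(Eucl n, ℂ)) := by
    rw [← coe_blockL2 hχ]
    exact (map_smul (Lp.toTemperedDistributionCLM ℂ (volume : Measure (Eucl n)) 2) _ _).symm
  rw [this, l2Norm_eq, ← ofReal_norm, norm_smul, Complex.norm_real, Real.norm_eq_abs,
    abs_of_nonneg hc]

/-- Bernstein's inequality for `∂_h Δ_k`, by duality. -/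
theorem norm_partialDeriv_mult_block_le (hχ : IsCutoff χ) (k : ℕ) (h : Fin n)
    (w : Lp ℂ 2 (volume : Measure (Eucl n))) (φ : 𝓢(Eucl n, ℂ)) :
    ‖partialDeriv h (w : 𝓢'(Eucl n, ℂ)) (mult (blockSymbol χ k) φ)‖ ≤
      4 * 2 ^ k * ‖blockL2 hχ k w‖ * sNorm φ := by
  have hs := symbol_hasTemperateGrowth (n := n) hχ (k + 1)
  have hb := blockSymbol_hasTemperateGrowth (n := n) hχ k
  have hd := derivSymbol_hasTemperateGrowth h
  have h1 : mult (blockSymbol χ k) φ =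
      mult (blockSymbol χ k) (mult (symbol χ (k + 1)) φ) := by
    rw [mult_mult hb hs]
    simp_rw [blockSymbol_mul_symbol hχ]
  -- On the support of the inserted cut-off, 2π|ξ| is below 1.9 · 2^(k+1) = 3.8 · 2^k.
  have h2 : ∀ ξ : Eucl n, ‖derivSymbol h ξ * symbol χ (k + 1) ξ‖ ≤ 4 * 2 ^ k := by
    intro ξ
    rcases le_or_gt (19 / 10 * (2 : ℝ) ^ ((k : ℤ) + 1)) (2 * Real.pi * ‖ξ‖) with h3 | h3
    · rw [symbol_eq_zero hχ h3, mul_zero, norm_zero]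
      positivity
    · rw [norm_mul]
      rw [zpow_add₀ two_ne_zero, zpow_natCast, zpow_one] at h3
      have h4 := norm_derivSymbol_le h ξ
      have h5 := norm_symbol_le hχ (k + 1) ξ
      have : (0 : ℝ) < 2 ^ k := by positivity
      calc _ ≤ ‖derivSymbol h ξ‖ * 1 := by gcongr
        _ ≤ 4 * 2 ^ k := by linarith
  rw [partialDeriv_apply, norm_neg, h1, mult_comm hd hb, mult_mult hd hs, ← block_apply hχ,
    ← coe_blockL2 hχ]
  refine (norm_L2_apply_le _ _).trans ?_
  calc _ ≤ ‖blockL2 hχ k w‖ * (4 * 2 ^ k * sNorm φ) := by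
        gcongr
        exact sNorm_mult_le' (hd.mul hs) h2 φ
    _ = _ := by ring

/-! ### Scaling of kernels -/

theorem fourierInv_comp_inv_smul (g : Eucl n → ℂ) {c : ℝ} (hc : 0 < c) (x : Eucl n) :
    𝓕⁻ (fun ξ => g (c⁻¹ • ξ)) x = ((c ^ n : ℝ) : ℂ) * 𝓕⁻ g (c • x) := by
  rw [Real.fourierInv_eq', Real.fourierInv_eq']
  have h := Measure.integral_comp_smul (volume : Measure (Eucl n))
    (fun v : Eucl n => Complex.exp ((2 * Real.pi * inner ℝ v (c • x) : ℝ) * Complex.I) • g v) c⁻¹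
  have h2 : |((c⁻¹) ^ Module.finrank ℝ (Eucl n))⁻¹| = c ^ n := by
    rw [finrank_euclideanSpace_fin, inv_pow, inv_inv, abs_of_pos (by positivity)]
  rw [h2, Complex.real_smul] at h
  rw [← h]
  congr 1
  funext ξ
  rw [real_inner_smul_left, real_inner_smul_right, inv_mul_cancel_left₀ hc.ne']

/-- Dilating the symbol by c contracts the kernel by c with preserved mass, so the p-th absolute
moment scales like c^(-p). The case p = 0 makes the S_k uniformly bounded on L^∞; p = 1 serves the
commutator estimate. -/
theorem integral_pow_mul_norm_fourierInv_comp_inv_smul (g : Eucl n → ℂ) {c : ℝ} (hc : 0 < c)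
    (p : ℕ) :
    ∫ x : Eucl n, ‖x‖ ^ p * ‖𝓕⁻ (fun ξ => g (c⁻¹ • ξ)) x‖ =
      (c ^ p)⁻¹ * ∫ x : Eucl n, ‖x‖ ^ p * ‖𝓕⁻ g x‖ := by
  have h := Measure.integral_comp_smul (volume : Measure (Eucl n))
    (fun x : Eucl n => ‖x‖ ^ p * ‖𝓕⁻ g x‖) c
  rw [finrank_euclideanSpace_fin, abs_of_pos (by positivity), smul_eq_mul] at h
  have h2 : ∀ x : Eucl n, ‖x‖ ^ p * ‖𝓕⁻ (fun ξ => g (c⁻¹ • ξ)) x‖ =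
      ((c ^ p)⁻¹ * c ^ n) * (‖c • x‖ ^ p * ‖𝓕⁻ g (c • x)‖) := by
    intro x
    rw [fourierInv_comp_inv_smul g hc, norm_mul, Complex.norm_real, Real.norm_eq_abs,
      abs_of_pos (by positivity), norm_smul, Real.norm_eq_abs, abs_of_pos hc, mul_pow]
    field_simp
  simp_rw [h2]
  rw [integral_const_mul, h]
  field_simp

/-- The convolution kernel of `S_k`. -/
def lowKernel (hχ : IsCutoff χ) (k : ℤ) : 𝓢(Eucl n, ℂ) := 𝓕⁻ (symbolS hχ k)

theorem lowKernel_coe (hχ : IsCutoff χ) (k : ℤ) :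
    (lowKernel hχ k : Eucl n → ℂ) = 𝓕⁻ (symbol χ k : Eucl n → ℂ) :=
  SchwartzMap.fourierInv_coe _

theorem integral_norm_lowKernel (hχ : IsCutoff χ) (k : ℤ) :
    ∫ x : Eucl n, ‖lowKernel hχ k x‖ = ∫ x : Eucl n, ‖lowKernel hχ 0 x‖ := by
  have h := integral_pow_mul_norm_fourierInv_comp_inv_smul (symbol χ 0 : Eucl n → ℂ)
    (c := 2 ^ k) (by positivity) 0
  simp_rw [← symbol_eq_symbol_zero] at h
  simpa [lowKernel_coe] using h

/-! ### Convolution of a Schwartz function with a bounded function -/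

section Smooth

variable {F : Type} [NormedAddCommGroup F] [NormedSpace ℝ F]

/-- One integrable majorant for all base points in a unit ball, as differentiation under the
integral sign requires. -/
theorem exists_schwartz_bound (K : 𝓢(Eucl n, F)) : ∃ B : Eucl n → ℝ, Integrable B ∧
    ∀ x z : Eucl n, dist x z < 1 → ∀ y, ‖K (x - y)‖ ≤ B (z - y) := by
  set p := (volume : Measure (Eucl n)).integrablePower
  obtain ⟨C, hC⟩ : ∃ C : ℝ, ∀ x, (1 + ‖x‖) ^ p * ‖K x‖ ≤ C :=
    ⟨_, fun x => by
      simpa using SchwartzMap.one_add_le_sup_seminorm_apply (𝕜 := ℝ) (m := (p, 0)) le_rfl le_rfl K x⟩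
  have hC0 : 0 ≤ C := le_trans (by positivity) (hC 0)
  refine ⟨fun x => C * 2 ^ p * (1 + ‖x‖) ^ (-(p : ℝ)),
    (Measure.integrable_pow_neg_integrablePower (volume : Measure (Eucl n))).const_mul _, ?_⟩
  intro x z hxz y
  have h1 : 1 + ‖z - y‖ ≤ 2 * (1 + ‖x - y‖) := by
    have : ‖z - y‖ ≤ ‖x - y‖ + dist x z := by
      rw [dist_comm, dist_eq_norm]
      calc ‖z - y‖ = ‖(x - y) + (z - x)‖ := by congr 1; abel
        _ ≤ _ := norm_add_le _ _
    have := norm_nonneg (x - y)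
    linarith
  simp only
  rw [Real.rpow_neg (by positivity), Real.rpow_natCast, ← div_eq_mul_inv, le_div_iff₀ (by positivity)]
  calc ‖K (x - y)‖ * (1 + ‖z - y‖) ^ p ≤ ‖K (x - y)‖ * (2 * (1 + ‖x - y‖)) ^ p := by gcongr
    _ = ((1 + ‖x - y‖) ^ p * ‖K (x - y)‖) * 2 ^ p := by rw [mul_pow]; ring
    _ ≤ C * 2 ^ p := by gcongr; exact hC _

variable [NormedSpace ℂ F]

theorem integrable_smul_schwartz {a : Eucl n → ℂ} (ha : Continuous a) {M : ℝ}
    (hM : ∀ x, ‖a x‖ ≤ M) (K : 𝓢(Eucl n, F)) (x : Eucl n) :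
    Integrable fun y => a y • K (x - y) :=
  (K.integrable.comp_sub_left x).bdd_smul M ha.aestronglyMeasurable (Filter.Eventually.of_forall hM)

theorem norm_integral_smul_schwartz_le {a : Eucl n → ℂ} {M : ℝ}
    (hM : ∀ x, ‖a x‖ ≤ M) (K : 𝓢(Eucl n, F)) (x : Eucl n) :
    ‖∫ y, a y • K (x - y)‖ ≤ M * ∫ y, ‖K y‖ := by
  rw [← integral_sub_left_eq_self (fun y => ‖K y‖) volume x, ← integral_const_mul]
  refine norm_integral_le_of_norm_le ((K.integrable.comp_sub_left x).norm.const_mul M)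
    (Filter.Eventually.of_forall fun y => ?_)
  rw [norm_smul]
  gcongr
  exact hM y

theorem hasFDerivAt_integral_smul_schwartz [SMulCommClass ℝ ℂ F]
    {a : Eucl n → ℂ} (ha : Continuous a) {M : ℝ}
    (hM : ∀ x, ‖a x‖ ≤ M) (K : 𝓢(Eucl n, F)) (x : Eucl n) :
    HasFDerivAt (fun x => ∫ y, a y • K (x - y))
      (∫ y, a y • SchwartzMap.fderivCLM ℝ (Eucl n) F K (x - y)) x := by
  obtain ⟨B, hB, hKB⟩ := exists_schwartz_bound (SchwartzMap.fderivCLM ℝ (Eucl n) F K)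
  have hM0 : 0 ≤ M := (norm_nonneg _).trans (hM 0)
  refine hasFDerivAt_integral_of_dominated_of_fderiv_le (bound := fun y => M * B (x - y))
    (F' := fun z y => a y • SchwartzMap.fderivCLM ℝ (Eucl n) F K (z - y))
    (Metric.ball_mem_nhds x one_pos)
    (Filter.Eventually.of_forall fun z => (integrable_smul_schwartz ha hM K z).aestronglyMeasurable)
    (integrable_smul_schwartz ha hM K x)
    (integrable_smul_schwartz ha hM (SchwartzMap.fderivCLM ℝ (Eucl n) F K) x).aestronglyMeasurable
    (Filter.Eventually.of_forall fun y z hz => ?_) ((hB.comp_sub_left x).const_mul M)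
    (Filter.Eventually.of_forall fun y z _ => ?_)
  · rw [norm_smul]
    have := hKB z x hz y
    gcongr
    exact hM y
  · have h1 : HasFDerivAt (fun z : Eucl n => z - y) (ContinuousLinearMap.id ℝ (Eucl n)) z :=
      (hasFDerivAt_id z).sub_const y
    have h2 := ((K.hasFDerivAt (z - y)).comp z h1).const_smul (a y)
    rw [ContinuousLinearMap.comp_id] at h2
    exact h2

end Smooth

/-- Derivatives fall on the kernel and leave an integral of the same type whose kernel takes values
in a space of linear maps. The induction therefore ranges over all target spaces. -/
theorem contDiff_integral_smul_schwartz {a : Eucl n → ℂ} (ha : Continuous a) {M : ℝ}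
    (hM : ∀ x, ‖a x‖ ≤ M) (N : ℕ) :
    ∀ (F : Type) [NormedAddCommGroup F] [NormedSpace ℝ F] [NormedSpace ℂ F] [SMulCommClass ℝ ℂ F]
      (K : 𝓢(Eucl n, F)), ContDiff ℝ N (fun x => ∫ y, a y • K (x - y)) ∧
        ∃ C, ∀ x, ‖iteratedFDeriv ℝ N (fun x => ∫ y, a y • K (x - y)) x‖ ≤ C := by
  induction N with
  | zero =>
    intro F _ _ _ _ K
    refine ⟨contDiff_zero.2 (continuous_iff_continuousAt.2 fun x =>
      (hasFDerivAt_integral_smul_schwartz ha hM K x).continuousAt), M * ∫ y, ‖K y‖, fun x => ?_⟩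
    rw [norm_iteratedFDeriv_zero]
    exact norm_integral_smul_schwartz_le hM K x
  | succ N ih =>
    intro F _ _ _ _ K
    have h := hasFDerivAt_integral_smul_schwartz ha hM K
    have h' : fderiv ℝ (fun x => ∫ y, a y • K (x - y)) =
        fun x => ∫ y, a y • SchwartzMap.fderivCLM ℝ (Eucl n) F K (x - y) :=
      funext fun x => (h x).fderiv
    obtain ⟨h1, C, hC⟩ := ih (Eucl n →L[ℝ] F) (SchwartzMap.fderivCLM ℝ (Eucl n) F K)
    refine ⟨?_, C, fun x => ?_⟩
    · push_cast
      rw [contDiff_succ_iff_fderiv, h']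
      exact ⟨fun x => (h x).differentiableAt, by simp, h1⟩
    · rw [← norm_iteratedFDeriv_fderiv, h']
      exact hC x

theorem hasTemperateGrowth_integral_smul_schwartz {a : Eucl n → ℂ} (ha : Continuous a) {M : ℝ}
    (hM : ∀ x, ‖a x‖ ≤ M) (K : 𝓢(Eucl n, ℂ)) :
    (fun x => ∫ y, a y • K (x - y)).HasTemperateGrowth := by
  refine ⟨contDiff_infty.2 fun N => (contDiff_integral_smul_schwartz ha hM N ℂ K).1, fun N => ?_⟩
  obtain ⟨C, hC⟩ := (contDiff_integral_smul_schwartz ha hM N ℂ K).2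
  exact ⟨0, C, by simpa using hC⟩

/-! ### The functions `S_k a` -/

theorem lowPassFun_of_nonneg (hχ : IsCutoff χ) {k : ℤ} (hk : 0 ≤ k) (a : Eucl n → ℂ) :
    lowPassFun χ k a = fun x => ∫ y, a y • lowKernel hχ k (x - y) := by
  funext x
  rw [lowPassFun, if_pos hk, lowKernel_coe]
  simp_rw [smul_eq_mul, mul_comm]

theorem lowPassFun_of_neg {k : ℤ} (hk : k < 0) (a : Eucl n → ℂ) :
    lowPassFun χ k a = fun _ => 0 := by
  funext x
  rw [lowPassFun, if_neg hk.not_ge]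

theorem lowPassFun_hasTemperateGrowth (hχ : IsCutoff χ) (k : ℤ) {a : Eucl n → ℂ}
    (ha : Continuous a) {M : ℝ} (hM : ∀ x, ‖a x‖ ≤ M) :
    (lowPassFun χ k a).HasTemperateGrowth := by
  rcases le_or_gt 0 k with hk | hk
  · rw [lowPassFun_of_nonneg hχ hk]
    exact hasTemperateGrowth_integral_smul_schwartz ha hM _
  · rw [lowPassFun_of_neg hk]
    exact .zero

/-- The `L¹` norm of the kernels of all the `S_k`. -/
def kernelConst (n : ℕ) (hχ : IsCutoff χ) : ℝ≥0 :=
  ⟨∫ x : Eucl n, ‖lowKernel hχ 0 x‖, integral_nonneg fun _ => norm_nonneg _⟩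

theorem norm_lowPassFun_le (hχ : IsCutoff χ) (k : ℤ) {a : Eucl n → ℂ} {M : ℝ}
    (hM : ∀ x, ‖a x‖ ≤ M) (x : Eucl n) :
    ‖lowPassFun χ k a x‖ ≤ M * kernelConst n hχ := by
  have hM0 : 0 ≤ M := (norm_nonneg _).trans (hM 0)
  rcases le_or_gt 0 k with hk | hk
  · rw [lowPassFun_of_nonneg hχ hk]
    refine (norm_integral_smul_schwartz_le hM _ x).trans_eq ?_
    rw [integral_norm_lowKernel]
    rfl
  · rw [lowPassFun_of_neg hk, norm_zero]
    positivity

/-- Writing the convolution with the translation on a, increments of a are averaged against the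
kernel, whose L¹ norm is independent of k. -/
theorem lipschitzWith_lowPassFun (hχ : IsCutoff χ) (k : ℤ) {a : Eucl n → ℂ} {M : ℝ}
    (hM : ∀ x, ‖a x‖ ≤ M) {L : ℝ≥0} (hL : LipschitzWith L a) :
    LipschitzWith (kernelConst n hχ * L) (lowPassFun χ k a) := by
  rcases le_or_gt 0 k with hk | hk
  · refine LipschitzWith.of_dist_le_mul fun x x' => ?_
    have h1 : ∀ x, lowPassFun χ k a x = ∫ z, a (x - z) • lowKernel hχ k z := by
      intro x
      rw [lowPassFun_of_nonneg hχ hk,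
        ← integral_sub_left_eq_self (fun z => a (x - z) • lowKernel hχ k z) volume x]
      simp
    have hi : ∀ x, Integrable fun z => a (x - z) • lowKernel hχ k z := fun x =>
      (lowKernel hχ k).integrable.bdd_smul M
        (hL.continuous.comp (by fun_prop)).aestronglyMeasurable
        (Filter.Eventually.of_forall fun z => hM _)
    rw [dist_eq_norm, h1, h1, ← integral_sub (hi x) (hi x')]
    have h2 : ((kernelConst n hχ * L : ℝ≥0) : ℝ) * dist x x' =
        ∫ z : Eucl n, (L * dist x x') * ‖lowKernel hχ k z‖ := by
      rw [integral_const_mul, integral_norm_lowKernel, NNReal.coe_mul]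
      change (∫ x : Eucl n, ‖lowKernel hχ 0 x‖) * L * dist x x' = _
      ring
    rw [h2]
    refine norm_integral_le_of_norm_le ((lowKernel hχ k).integrable.norm.const_mul _)
      (Filter.Eventually.of_forall fun z => ?_)
    rw [← sub_smul, norm_smul]
    gcongr
    have := hL.dist_le_mul (x - z) (x' - z)
    rwa [dist_eq_norm, dist_sub_right] at this
  · rw [lowPassFun_of_neg hk]
    exact LipschitzWith.const' 0

/-- The infimum is attained, because each two-point inequality survives passage to the infimum. -/
theorem lipschitzWith_lipNorm {a : Eucl n → ℂ} (h : ∃ K : ℝ≥0, LipschitzWith K a) :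
    LipschitzWith (lipNorm a) a := by
  refine LipschitzWith.of_dist_le_mul fun x y => ?_
  rcases eq_or_ne x y with rfl | hxy
  · simp
  · have hd : 0 < dist x y := dist_pos.2 hxy
    rw [← div_le_iff₀ hd]
    rw [← Real.toNNReal_le_iff_le_coe]
    refine le_csInf h fun K hK => ?_
    rw [Real.toNNReal_le_iff_le_coe, div_le_iff₀ hd]
    exact LipschitzWith.dist_le_mul hK x y

/-! ### Spectral localization of products -/

/-- Pointwise multiplication of a Schwartz function by a function of temperate growth. -/
abbrev pmul (b : Eucl n → ℂ) : 𝓢(Eucl n, ℂ) →L[ℂ] 𝓢(Eucl n, ℂ) := SchwartzMap.smulLeftCLM ℂ b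

theorem pmul_apply {b : Eucl n → ℂ} (hb : b.HasTemperateGrowth) (φ : 𝓢(Eucl n, ℂ)) (x : Eucl n) :
    pmul b φ x = b x * φ x := by
  rw [SchwartzMap.smulLeftCLM_apply_apply hb, smul_eq_mul]

theorem fourier_comp_sub_eq_zero {K : Eucl n → ℂ} {t : Eucl n} (h : 𝓕 K t = 0) (y : Eucl n) :
    𝓕 (fun x => K (x - y)) t = 0 := by
  rw [Real.fourier_eq'] at h ⊢
  rw [← integral_add_right_eq_self _ y]
  simp only [add_sub_cancel_right]
  have h1 : ∀ v : Eucl n, Complex.exp ((-2 * Real.pi * inner ℝ (v + y) t : ℝ) * Complex.I) • K v =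
      Complex.exp ((-2 * Real.pi * inner ℝ y t : ℝ) * Complex.I) *
        (Complex.exp ((-2 * Real.pi * inner ℝ v t : ℝ) * Complex.I) • K v) := by
    intro v
    rw [smul_eq_mul, smul_eq_mul, ← mul_assoc, ← Complex.exp_add, inner_add_left]
    push_cast
    ring_nf
  simp_rw [h1]
  rw [integral_const_mul, h, mul_zero]

/-- The transform of the product is a convolution, and the hypothesis kills its integrand at every
t. -/
theorem fourier_mul_eq_zero (K φ : 𝓢(Eucl n, ℂ)) {ξ : Eucl n}
    (h : ∀ t, 𝓕 K (-t) = 0 ∨ 𝓕 φ (ξ + t) = 0) : 𝓕 (fun x => K x * φ x) ξ = 0 := by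
  have h1 : SchwartzMap.convolution (ContinuousLinearMap.mul ℂ ℂ) (𝓕⁻ K) (𝓕⁻ φ) =
      𝓕⁻ (SchwartzMap.pairing (ContinuousLinearMap.mul ℂ ℂ) K φ) := by
    simp [SchwartzMap.convolution]
  have h2 : (fun x => K x * φ x) = SchwartzMap.pairing (ContinuousLinearMap.mul ℂ ℂ) K φ := by
    ext x
    simp
  have h3 : 𝓕 (fun x => K x * φ x) ξ =
      (𝓕⁻ (SchwartzMap.pairing (ContinuousLinearMap.mul ℂ ℂ) K φ)) (-ξ) := by
    rw [SchwartzMap.fourierInv_coe, Real.fourierInv_eq_fourier_neg, neg_neg, h2]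
  rw [h3, ← h1, SchwartzMap.convolution_apply, MeasureTheory.convolution]
  refine integral_eq_zero_of_ae (Filter.Eventually.of_forall fun t => ?_)
  simp only [ContinuousLinearMap.mul_apply', Pi.zero_apply]
  rw [SchwartzMap.fourierInv_coe, SchwartzMap.fourierInv_coe, Real.fourierInv_eq_fourier_neg,
    Real.fourierInv_eq_fourier_neg, ← SchwartzMap.fourier_coe, ← SchwartzMap.fourier_coe]
  rcases h t with h | h
  · rw [h, zero_mul]
  · rw [show -(-ξ - t) = ξ + t by abel, h, mul_zero]

theorem integrable_smul_mul_schwartz {a : Eucl n → ℂ} (ha : Continuous a) {M : ℝ}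
    (hM : ∀ x, ‖a x‖ ≤ M) (K φ : 𝓢(Eucl n, ℂ)) :
    Integrable (fun p : Eucl n × Eucl n => a p.2 * (K (p.1 - p.2) * φ p.1))
      (volume.prod volume) := by
  have h1 : Integrable (fun p : Eucl n × Eucl n => φ p.2 * K (-(p.1 - p.2)))
      (volume.prod volume) :=
    φ.integrable.convolution_integrand (ContinuousLinearMap.mul ℂ ℂ)
      (g := fun z => K (-z)) K.integrable.comp_neg
  have h2 : Integrable (fun p : Eucl n × Eucl n => K (p.1 - p.2) * φ p.1)
      (volume.prod volume) := by
    refine h1.swap.congr (Filter.Eventually.of_forall fun p => ?_)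
    simp [mul_comm]
  exact h2.bdd_mul (c := M) (ha.comp continuous_snd).aestronglyMeasurable
    (Filter.Eventually.of_forall fun p => hM p.2)

/-- The function a is merely bounded, so its spectrum is not handled directly. Instead K * a is a
superposition of translates of K; translation only modulates 𝓕 K, so each translate times φ has no
spectrum at ξ, and Fubini concludes. -/
theorem fourier_pmul_integral_eq_zero {a : Eucl n → ℂ} (ha : Continuous a) {M : ℝ}
    (hM : ∀ x, ‖a x‖ ≤ M) (K φ : 𝓢(Eucl n, ℂ)) {ξ : Eucl n}
    (h : ∀ t, 𝓕 K (-t) = 0 ∨ 𝓕 φ (ξ + t) = 0) :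
    𝓕 (pmul (fun x => ∫ y, a y • K (x - y)) φ) ξ = 0 := by
  rw [SchwartzMap.fourier_coe, Real.fourier_eq]
  have h1 : ∀ z : Eucl n, Real.fourierChar (-inner ℝ z ξ) •
      pmul (fun x => ∫ y, a y • K (x - y)) φ z =
      ∫ y, Real.fourierChar (-inner ℝ z ξ) • (a y * (K (z - y) * φ z)) := by
    intro z
    rw [pmul_apply (hasTemperateGrowth_integral_smul_schwartz ha hM K)]
    simp only [Circle.smul_def]
    rw [integral_smul, ← integral_mul_const]
    simp_rw [smul_eq_mul, mul_assoc]
  simp_rw [h1]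
  rw [integral_integral_swap]
  · refine integral_eq_zero_of_ae (Filter.Eventually.of_forall fun y => ?_)
    have h2 := fourier_mul_eq_zero (SchwartzMap.compSubConstCLM ℂ y K) φ (ξ := ξ) fun t => by
      rcases h t with h | h
      · left
        rw [SchwartzMap.fourier_coe] at h ⊢
        have := fourier_comp_sub_eq_zero h y
        exact this
      · exact Or.inr h
    rw [Real.fourier_eq] at h2
    simp only [SchwartzMap.compSubConstCLM_apply] at h2
    have h3 : ∀ z : Eucl n, Real.fourierChar (-inner ℝ z ξ) • (a y * (K (z - y) * φ z)) =
        a y * Real.fourierChar (-inner ℝ z ξ) • (K (z - y) * φ z) := by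
      intro z
      simp only [Circle.smul_def, smul_eq_mul]
      ring
    simp_rw [h3]
    rw [integral_const_mul, h2, mul_zero]
    rfl
  · refine (integrable_smul_mul_schwartz ha hM K φ).mono ?_ ?_
    · have hc : Continuous fun p : Eucl n × Eucl n => Real.fourierChar (-inner ℝ p.1 ξ) :=
        Real.continuous_fourierChar.comp (by fun_prop)
      exact hc.aestronglyMeasurable.smul
        (integrable_smul_mul_schwartz ha hM K φ).aestronglyMeasurable
    · exact Filter.Eventually.of_forall fun p => by simp [Function.uncurry]

theorem fourier_pmul_lowPassFun_eq_zero (hχ : IsCutoff χ) (k : ℤ) {a : Eucl n → ℂ}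
    (ha : Continuous a) {M : ℝ} (hM : ∀ x, ‖a x‖ ≤ M) (φ : 𝓢(Eucl n, ℂ)) {ξ : Eucl n}
    (h : ∀ t : Eucl n, 2 * Real.pi * ‖t‖ < 19 / 10 * 2 ^ k → 𝓕 φ (ξ + t) = 0) :
    𝓕 (pmul (lowPassFun χ k a) φ) ξ = 0 := by
  rcases le_or_gt 0 k with hk | hk
  · rw [lowPassFun_of_nonneg hχ hk]
    apply fourier_pmul_integral_eq_zero ha hM
    intro t
    rcases lt_or_ge (2 * Real.pi * ‖t‖) (19 / 10 * 2 ^ k) with h1 | h1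
    · exact Or.inr (h t h1)
    · left
      rw [lowKernel, FourierTransform.fourier_fourierInv_eq, symbolS_apply, symbol_neg,
        symbol_eq_zero hχ h1]
  · rw [lowPassFun_of_neg hk, pmul, SchwartzMap.smulLeftCLM_const]
    simp

theorem mult_pmul_mult_eq_zero (hχ : IsCutoff χ) (l : ℤ) {a : Eucl n → ℂ}
    (ha : Continuous a) {M : ℝ} (hM : ∀ x, ‖a x‖ ≤ M) {g g' : Eucl n → ℂ}
    (hg : g.HasTemperateGrowth) (hg' : g'.HasTemperateGrowth)
    (h : ∀ ξ t : Eucl n, g ξ ≠ 0 → 2 * Real.pi * ‖t‖ < 19 / 10 * 2 ^ l → g' (ξ + t) = 0)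
    (φ : 𝓢(Eucl n, ℂ)) : mult g (pmul (lowPassFun χ l a) (mult g' φ)) = 0 := by
  apply schwartz_ext_fourier
  intro ξ
  rw [fourier_mult hg, FourierTransform.fourier_zero]
  by_cases hξ : g ξ = 0
  · rw [hξ, zero_mul]
    rfl
  · rw [fourier_pmul_lowPassFun_eq_zero hχ l ha hM, mul_zero]
    · rfl
    · intro t ht
      rw [fourier_mult hg', h ξ t hξ ht, zero_mul]

theorem two_pi_mul_norm_add_le (ξ t : Eucl n) :
    2 * Real.pi * ‖ξ + t‖ ≤ 2 * Real.pi * ‖ξ‖ + 2 * Real.pi * ‖t‖ := by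
  rw [← mul_add]
  have := norm_add_le ξ t
  gcongr

theorem le_two_pi_mul_norm_add (ξ t : Eucl n) :
    2 * Real.pi * ‖ξ‖ - 2 * Real.pi * ‖t‖ ≤ 2 * Real.pi * ‖ξ + t‖ := by
  rw [← mul_sub]
  have : ‖ξ‖ - ‖t‖ ≤ ‖ξ + t‖ := by
    have := norm_sub_norm_le ξ (-t)
    rwa [norm_neg, sub_neg_eq_add] at this
  gcongr

/-- The product S_i a · S_i φ has frequencies at most 3.8 · 2^i, while the block of index i + 3
starts at 4.4 · 2^i. -/
theorem mult_block_pmul_lowPass_eq_zero (hχ : IsCutoff χ) (i : ℕ) {a : Eucl n → ℂ}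
    (ha : Continuous a) {M : ℝ} (hM : ∀ x, ‖a x‖ ≤ M) (φ : 𝓢(Eucl n, ℂ)) :
    mult (blockSymbol χ (i + 3)) (pmul (lowPassFun χ i a) (mult (symbol χ i) φ)) = 0 := by
  refine mult_pmul_mult_eq_zero hχ i ha hM (blockSymbol_hasTemperateGrowth hχ _)
    (symbol_hasTemperateGrowth hχ _) (fun ξ t h ht => symbol_eq_zero hχ ?_) φ
  have h1 : 11 / 20 * (2 : ℝ) ^ (i + 3) < 2 * Real.pi * ‖ξ‖ := by
    by_contra! h'
    exact h (blockSymbol_eq_zero_of_ge hχ (by omega) h')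
  have h2 := le_two_pi_mul_norm_add ξ t
  rw [pow_add] at h1
  rw [zpow_natCast] at ht ⊢
  have h3 : (0 : ℝ) < 2 ^ i := by positivity
  linarith

/-- The index of the low-frequency factor which goes with the block `Δ_k` in `T_a^m`. -/
def lowIndex (m k : ℕ) : ℤ := (max k (m + 2) : ℕ) - 3

/-- Multiplication by S_l a shifts frequencies by at most 1.9 · 2^l. For large k one has l = k - 3,
a small shift relative to 2^k. For small k the index l may exceed k, being m - 1, but it never
exceeds k + m; this is why the required gap grows with m. -/
theorem mult_block_pmul_block_eq_zero (hχ : IsCutoff χ) {m k ν : ℕ} {a : Eucl n → ℂ}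
    (ha : Continuous a) {M : ℝ} (hM : ∀ x, ‖a x‖ ≤ M)
    (hkν : ν + m + 6 ≤ k ∨ k + m + 6 ≤ ν) (φ : 𝓢(Eucl n, ℂ)) :
    mult (blockSymbol χ k) (pmul (lowPassFun χ (lowIndex m k) a) (mult (blockSymbol χ ν) φ)) =
      0 := by
  refine mult_pmul_mult_eq_zero hχ _ ha hM (blockSymbol_hasTemperateGrowth hχ _)
    (blockSymbol_hasTemperateGrowth hχ _) (fun ξ t h ht => ?_) φ
  rcases hkν with hk | hν
  · apply blockSymbol_eq_zero_of_le hχ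
    have h1 : 11 / 20 * (2 : ℝ) ^ k < 2 * Real.pi * ‖ξ‖ := by
      by_contra! h'
      exact h (blockSymbol_eq_zero_of_ge hχ (by omega) h')
    have h2 := le_two_pi_mul_norm_add ξ t
    have h3 : (2 : ℝ) ^ lowIndex m k = 2 ^ k / 8 := by
      rw [lowIndex, max_eq_left (by omega), zpow_sub₀ two_ne_zero, zpow_natCast]
      norm_num
    have h4 : (2 : ℝ) ^ ν * 2 ^ 6 ≤ 2 ^ k := by
      rw [← pow_add]
      exact pow_le_pow_right₀ one_le_two (by omega)
    rw [h3] at ht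
    have h5 : (0 : ℝ) < 2 ^ ν := by positivity
    linarith
  · apply blockSymbol_eq_zero_of_ge hχ (by omega)
    have h1 : 2 * Real.pi * ‖ξ‖ < 19 / 10 * 2 ^ k := by
      by_contra! h'
      exact h (blockSymbol_eq_zero_of_le hχ h')
    have h2 := two_pi_mul_norm_add_le ξ t
    have h3 : (2 : ℝ) ^ lowIndex m k ≤ 2 ^ (k + m) := by
      rw [← zpow_natCast]
      exact zpow_le_zpow_right₀ one_le_two (by rw [lowIndex]; omega)
    have h4 : (2 : ℝ) ^ (k + m) * 2 ^ 6 ≤ 2 ^ ν := by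
      rw [← pow_add]
      exact pow_le_pow_right₀ one_le_two (by omega)
    have h5 : (2 : ℝ) ^ k ≤ 2 ^ (k + m) := pow_le_pow_right₀ one_le_two (by omega)
    have h6 : (0 : ℝ) < 2 ^ (k + m) := by positivity
    linarith

theorem mult_block_mult_block_eq_zero (hχ : IsCutoff χ) {k ν : ℕ}
    (hkν : ν + 6 ≤ k ∨ k + 6 ≤ ν) (φ : 𝓢(Eucl n, ℂ)) :
    mult (blockSymbol χ k) (mult (blockSymbol χ ν) φ) = 0 := by
  have hsep : ∀ {k ν : ℕ}, ν + 6 ≤ k → ∀ ξ : Eucl n, blockSymbol χ k ξ * blockSymbol χ ν ξ = 0 := by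
    intro k ν hk ξ
    rcases le_or_gt (2 * Real.pi * ‖ξ‖) (11 / 20 * 2 ^ k) with h | h
    · rw [blockSymbol_eq_zero_of_ge hχ (by omega) h, zero_mul]
    · have h4 : (2 : ℝ) ^ ν * 2 ^ 6 ≤ 2 ^ k := by
        rw [← pow_add]
        exact pow_le_pow_right₀ one_le_two (by omega)
      rw [blockSymbol_eq_zero_of_le hχ (k := ν) (by linarith [pow_pos (two_pos (α := ℝ)) ν]),
        mul_zero]
  have h : ∀ ξ : Eucl n, blockSymbol χ k ξ * blockSymbol χ ν ξ = 0 := by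
    intro ξ
    rcases hkν with hk | hν
    · exact hsep hk ξ
    · rw [mul_comm]
      exact hsep hν ξ
  rw [mult_mult (blockSymbol_hasTemperateGrowth hχ k) (blockSymbol_hasTemperateGrowth hχ ν)]
  simp_rw [h, mult]
  rw [SchwartzMap.fourierMultiplierCLM_const, zero_smul]
  rfl

/-! ### Young's inequality `L¹ * L² ⊆ L²` -/

/-- Cauchy–Schwarz after splitting κ f as κ^(1/2) · κ^(1/2) f. -/
theorem sq_lintegral_mul_le {α : Type*} [MeasurableSpace α] {μ : Measure α} {κ f : α → ℝ≥0∞}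
    (hκ : Measurable κ) (hf : Measurable f) :
    (∫⁻ t, κ t * f t ∂μ) ^ 2 ≤ (∫⁻ t, κ t ∂μ) * ∫⁻ t, κ t * f t ^ 2 ∂μ := by
  have h := ENNReal.lintegral_mul_le_Lp_mul_Lq μ Real.HolderConjugate.two_two
    (f := fun t => κ t ^ (1 / 2 : ℝ)) (g := fun t => κ t ^ (1 / 2 : ℝ) * f t)
    (by fun_prop) (by fun_prop)
  have h1 : ∀ t, (κ t ^ (1 / 2 : ℝ)) ^ (2 : ℝ) = κ t := fun t => by
    rw [← ENNReal.rpow_mul]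
    norm_num
  have h2 : ∀ t, κ t ^ (1 / 2 : ℝ) * (κ t ^ (1 / 2 : ℝ) * f t) = κ t * f t := fun t => by
    rw [← mul_assoc, ← ENNReal.rpow_add_of_nonneg _ _ (by norm_num) (by norm_num)]
    norm_num
  have h3 : ∀ t, (κ t ^ (1 / 2 : ℝ) * f t) ^ (2 : ℝ) = κ t * f t ^ 2 := fun t => by
    rw [ENNReal.mul_rpow_of_nonneg _ _ (by norm_num), h1, ENNReal.rpow_two]
  simp only [Pi.mul_apply, h1, h2, h3] at h
  calc _ ≤ ((∫⁻ t, κ t ∂μ) ^ (1 / 2 : ℝ) * (∫⁻ t, κ t * f t ^ 2 ∂μ) ^ (1 / 2 : ℝ)) ^ 2 := by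
        gcongr
    _ = _ := by
        rw [mul_pow, ← ENNReal.rpow_two, ← ENNReal.rpow_two, ← ENNReal.rpow_mul,
          ← ENNReal.rpow_mul]
        norm_num

theorem lintegral_sq_convolution_le {κ f : Eucl n → ℝ≥0∞} (hκ : Measurable κ)
    (hf : Measurable f) :
    ∫⁻ x, (∫⁻ t, κ t * f (x - t)) ^ 2 ≤ (∫⁻ t, κ t) ^ 2 * ∫⁻ x, f x ^ 2 := by
  have hm : Measurable fun p : Eucl n × Eucl n => κ p.2 * f (p.1 - p.2) ^ 2 := by fun_prop
  calc _ ≤ ∫⁻ x, (∫⁻ t, κ t) * ∫⁻ t, κ t * f (x - t) ^ 2 :=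
        lintegral_mono fun x => sq_lintegral_mul_le hκ (hf.comp (measurable_const.sub measurable_id))
    _ = (∫⁻ t, κ t) * ∫⁻ x, ∫⁻ t, κ t * f (x - t) ^ 2 := by
        rw [lintegral_const_mul _ hm.lintegral_prod_right']
    _ = (∫⁻ t, κ t) * ∫⁻ t, ∫⁻ x, κ t * f (x - t) ^ 2 := by
        rw [lintegral_lintegral_swap]
        exact hm.aemeasurable
    _ = (∫⁻ t, κ t) * ∫⁻ t, κ t * ∫⁻ x, f x ^ 2 := by
        congr 1
        refine lintegral_congr fun t => ?_
        rw [lintegral_const_mul _ (by fun_prop)]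
        congr 1
        exact lintegral_sub_right_eq_self (fun x => f x ^ 2) t
    _ = _ := by
        rw [lintegral_mul_const _ hκ, sq, mul_assoc]

theorem lintegral_enorm_sq_eq (φ : 𝓢(Eucl n, ℂ)) :
    ∫⁻ x, ‖φ x‖ₑ ^ 2 = ENNReal.ofReal (sNorm φ) ^ 2 := by
  have h := eLpNorm_nnreal_pow_eq_lintegral (f := φ) (μ := (volume : Measure (Eucl n)))
    (p := 2) two_ne_zero
  rw [sNorm, SchwartzMap.norm_toLp, ENNReal.ofReal_toReal (φ.memLp 2 volume).2.ne]
  simpa using h.symm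

theorem sNorm_le_of_convolution_bound {φ ψ : 𝓢(Eucl n, ℂ)} {κ : Eucl n → ℝ}
    (hκ : Integrable κ) (hκ0 : ∀ t, 0 ≤ κ t) (hκm : Measurable κ)
    (h : ∀ x, ‖ψ x‖ₑ ≤ ∫⁻ t, ENNReal.ofReal (κ t) * ‖φ (x - t)‖ₑ) :
    sNorm ψ ≤ (∫ t, κ t) * sNorm φ := by
  have h1 : ENNReal.ofReal (sNorm ψ) ^ 2 ≤ ENNReal.ofReal ((∫ t, κ t) * sNorm φ) ^ 2 := by
    rw [← lintegral_enorm_sq_eq, ENNReal.ofReal_mul (integral_nonneg hκ0), mul_pow,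
      ← lintegral_enorm_sq_eq, ofReal_integral_eq_lintegral_ofReal hκ
        (Filter.Eventually.of_forall hκ0)]
    refine le_trans (lintegral_mono fun x => ?_)
      (lintegral_sq_convolution_le hκm.ennreal_ofReal φ.continuous.enorm.measurable)
    gcongr
    exact h x
  have h2 : 0 ≤ (∫ t, κ t) * sNorm φ := mul_nonneg (integral_nonneg hκ0) (norm_nonneg _)
  rwa [ENNReal.pow_le_pow_left_iff two_ne_zero, ENNReal.ofReal_le_ofReal_iff h2] at h1

/-! ### Commutators of multipliers and Lipschitz functions -/

theorem mult_schwartz_apply (G φ : 𝓢(Eucl n, ℂ)) (x : Eucl n) :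
    mult G φ x = ∫ t, (𝓕⁻ G) t * φ (x - t) := by
  have h : mult G φ = SchwartzMap.convolution (ContinuousLinearMap.mul ℂ ℂ) (𝓕⁻ G) φ := by
    apply schwartz_ext_fourier
    intro ξ
    rw [fourier_mult G.hasTemperateGrowth, SchwartzMap.fourier_convolution,
      SchwartzMap.pairing_apply_apply, FourierTransform.fourier_fourierInv_eq]
    rfl
  rw [h, SchwartzMap.convolution_apply]
  rfl

/-- The commutator has kernel (b(x) - b(x - t)) 𝓕⁻G(t), bounded by L |t| |𝓕⁻G(t)|; Young's
inequality then gives the first moment. -/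
theorem sNorm_commutator_le (G : 𝓢(Eucl n, ℂ)) {b : Eucl n → ℂ} (hb : b.HasTemperateGrowth)
    {L : ℝ≥0} (hL : LipschitzWith L b) (φ : 𝓢(Eucl n, ℂ)) :
    sNorm (pmul b (mult G φ) - mult G (pmul b φ)) ≤
      L * (∫ t, ‖t‖ ^ 1 * ‖(𝓕⁻ G) t‖) * sNorm φ := by
  have hi : Integrable fun t => (L : ℝ) * (‖t‖ ^ 1 * ‖(𝓕⁻ G) t‖) :=
    ((𝓕⁻ G).integrable_pow_mul volume 1).const_mul _
  rw [← integral_const_mul]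
  have hc : Continuous fun t => ‖(𝓕⁻ G) t‖ := (𝓕⁻ G).continuous.norm
  refine sNorm_le_of_convolution_bound hi (fun t => by positivity) (by fun_prop) fun x => ?_
  have hint : ∀ ψ : 𝓢(Eucl n, ℂ), Integrable fun t => (𝓕⁻ G) t * ψ (x - t) := fun ψ => by
    have := ((𝓕⁻ G).integrable (μ := volume)).mul_bdd (c := ‖ψ.toBoundedContinuousFunction‖)
      (g := fun t => ψ (x - t))
      (ψ.continuous.comp (continuous_const.sub continuous_id)).aestronglyMeasurable
      (Filter.Eventually.of_forall fun t => ψ.toBoundedContinuousFunction.norm_coe_le_norm _)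
    exact this
  have h1 : (pmul b (mult G φ) - mult G (pmul b φ)) x =
      ∫ t, (b x - b (x - t)) * ((𝓕⁻ G) t * φ (x - t)) := by
    rw [sub_apply, pmul_apply hb, mult_schwartz_apply, mult_schwartz_apply, ← integral_const_mul,
      ← integral_sub ((hint φ).const_mul _) (hint _)]
    congr 1
    funext t
    rw [pmul_apply hb]
    ring
  rw [h1]
  refine (enorm_integral_le_lintegral_enorm _).trans (lintegral_mono fun t => ?_)
  rw [← mul_assoc, enorm_mul]
  gcongr
  rw [← ofReal_norm, norm_mul]
  apply ENNReal.ofReal_le_ofReal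
  have := hL.dist_le_mul x (x - t)
  rw [dist_eq_norm, dist_eq_norm, sub_sub_cancel] at this
  rw [pow_one, ← mul_assoc]
  gcongr

/-- The symbol of `∂_{x_j} S_k`, as a Schwartz function. -/
def derivLowS (hχ : IsCutoff χ) (j : Fin n) (k : ℤ) : 𝓢(Eucl n, ℂ) :=
  pmul (derivSymbol j) (symbolS hχ k)

theorem derivLowS_apply (hχ : IsCutoff χ) (j : Fin n) (k : ℤ) (ξ : Eucl n) :
    derivLowS hχ j k ξ = derivSymbol j ξ * symbol χ k ξ :=
  pmul_apply (derivSymbol_hasTemperateGrowth j) _ _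

/-- The symbol of ∂_j S_k is 2^k times a dilate of that of ∂_j S_0, and the first moment of the
dilated kernel gains 2^(-k): the two factors cancel. This is how the Lipschitz bound on b absorbs
one derivative. -/
theorem integral_norm_mul_derivLow (hχ : IsCutoff χ) (j : Fin n) (k : ℤ) :
    ∫ t : Eucl n, ‖t‖ ^ 1 * ‖(𝓕⁻ (derivLowS hχ j k)) t‖ =
      ∫ t : Eucl n, ‖t‖ ^ 1 * ‖(𝓕⁻ (derivLowS hχ j 0)) t‖ := by
  have hk : (0 : ℝ) < 2 ^ k := by positivity
  have h1 : derivLowS hχ j k =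
      ((2 ^ k : ℝ) : ℂ) • fun ξ : Eucl n => derivLowS hχ j 0 (((2 : ℝ) ^ k)⁻¹ • ξ) := by
    funext ξ
    simp only [Pi.smul_apply]
    rw [derivLowS_apply, derivLowS_apply, ← symbol_eq_symbol_zero, derivSymbol, derivSymbol,
      real_inner_smul_left, smul_eq_mul]
    push_cast
    have : ((2 : ℂ) ^ k) ≠ 0 := zpow_ne_zero _ two_ne_zero
    field_simp
  have h2 : ∀ t : Eucl n, ‖t‖ ^ 1 * ‖(𝓕⁻ (derivLowS hχ j k)) t‖ = 2 ^ k *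
      (‖t‖ ^ 1 * ‖𝓕⁻ (fun ξ : Eucl n => derivLowS hχ j 0 (((2 : ℝ) ^ k)⁻¹ • ξ)) t‖) := by
    intro t
    rw [SchwartzMap.fourierInv_coe, h1, Real.fourierInv_eq', Real.fourierInv_eq']
    simp only [Pi.smul_apply, smul_comm _ ((2 ^ k : ℝ) : ℂ)]
    rw [integral_smul, norm_smul, Complex.norm_real, Real.norm_eq_abs, abs_of_pos hk]
    ring
  simp_rw [h2]
  rw [integral_const_mul, integral_pow_mul_norm_fourierInv_comp_inv_smul _ hk, pow_one,
    mul_inv_cancel_left₀ hk.ne', SchwartzMap.fourierInv_coe]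

/-- The constant in the commutator estimate. -/
def commConst (hχ : IsCutoff χ) (j : Fin n) : ℝ :=
  ∫ t : Eucl n, ‖t‖ ^ 1 * ‖(𝓕⁻ (derivLowS hχ j 0)) t‖

theorem commConst_nonneg (hχ : IsCutoff χ) (j : Fin n) : 0 ≤ commConst hχ j :=
  integral_nonneg fun t => by positivity

theorem sNorm_commutator_low_le (hχ : IsCutoff χ) (j : Fin n) (k : ℤ) {b : Eucl n → ℂ}
    (hb : b.HasTemperateGrowth) {L : ℝ≥0} (hL : LipschitzWith L b) (φ : 𝓢(Eucl n, ℂ)) :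
    sNorm (pmul b (mult (lowSymbol χ k) (mult (derivSymbol j) φ)) -
      mult (lowSymbol χ k) (mult (derivSymbol j) (pmul b φ))) ≤
      L * commConst hχ j * sNorm φ := by
  rcases le_or_gt 0 k with hk | hk
  · have h : ∀ φ : 𝓢(Eucl n, ℂ), mult (lowSymbol χ k) (mult (derivSymbol j) φ) =
        mult (derivLowS hχ j k) φ := fun φ => by
      rw [lowSymbol_of_nonneg hk, mult_comm (symbol_hasTemperateGrowth hχ k)
        (derivSymbol_hasTemperateGrowth j), mult_mult (derivSymbol_hasTemperateGrowth j)
        (symbol_hasTemperateGrowth hχ k)]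
      congr 2
      funext ξ
      rw [derivLowS_apply]
    rw [h, h, commConst, ← integral_norm_mul_derivLow hχ j k]
    exact sNorm_commutator_le _ hb hL φ
  · have h : ∀ φ : 𝓢(Eucl n, ℂ), mult (lowSymbol χ k) φ = 0 := fun φ => by
      rw [lowSymbol_of_neg hk, mult, SchwartzMap.fourierMultiplierCLM_const, zero_smul]
      rfl
    rw [h, h, map_zero, sub_zero]
    rw [sNorm_zero]
    have := commConst_nonneg hχ j
    positivity

/-- By the Leibniz rule the commutator is multiplication by ∂_j b, which is bounded by L. -/
theorem sNorm_deriv_commutator_le (j : Fin n) {b : Eucl n → ℂ}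
    (hb : b.HasTemperateGrowth) {L : ℝ≥0} (hL : LipschitzWith L b) (φ : 𝓢(Eucl n, ℂ)) :
    sNorm (mult (derivSymbol j) (pmul b φ) - pmul b (mult (derivSymbol j) φ)) ≤ L * sNorm φ := by
  apply sNorm_le_of_pointwise
  intro x
  have hd : DifferentiableAt ℝ b x := (hb.1.differentiable (by simp)).differentiableAt
  have h1 : (pmul b φ : Eucl n → ℂ) = fun x => b x * φ x := funext (pmul_apply hb φ)
  rw [sub_apply, pmul_apply hb, ← lineDeriv_eq_mult, ← lineDeriv_eq_mult,
    SchwartzMap.lineDerivOp_apply_eq_fderiv, SchwartzMap.lineDerivOp_apply_eq_fderiv, h1,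
    fderiv_fun_mul hd φ.differentiableAt]
  simp only [add_apply, smul_apply, smul_eq_mul, add_sub_cancel_left]
  rw [norm_mul, mul_comm]
  gcongr
  calc _ ≤ ‖fderiv ℝ b x‖ * ‖basisVec j‖ := ContinuousLinearMap.le_opNorm _ _
    _ ≤ L * 1 := by
        gcongr
        · exact norm_fderiv_le_of_lipschitz ℝ hL
        · simp
    _ = L := mul_one _

/-- Commuting b past Δ_ν alone differs from commuting it past Δ_ν ∂_j by Δ_ν [∂_j, b]. Since Δ_ν is
a difference of two low-pass operators, the former costs two commutator constants and the latter the
remaining 1. -/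
theorem sNorm_block_commutator_le (hχ : IsCutoff χ) (j : Fin n) (ν : ℕ) {b : Eucl n → ℂ}
    (hb : b.HasTemperateGrowth) {L : ℝ≥0} (hL : LipschitzWith L b) (φ : 𝓢(Eucl n, ℂ)) :
    sNorm (pmul b (mult (blockSymbol χ ν) (mult (derivSymbol j) φ)) -
      mult (blockSymbol χ ν) (pmul b (mult (derivSymbol j) φ))) ≤
      L * (2 * commConst hχ j + 1) * sNorm φ := by
  set ρ := mult (derivSymbol j) (pmul b φ) - pmul b (mult (derivSymbol j) φ) with hρ
  have h1 : pmul b (mult (blockSymbol χ ν) (mult (derivSymbol j) φ)) -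
      mult (blockSymbol χ ν) (pmul b (mult (derivSymbol j) φ)) =
      (pmul b (mult (lowSymbol χ ν) (mult (derivSymbol j) φ)) -
        mult (lowSymbol χ ν) (mult (derivSymbol j) (pmul b φ))) -
      (pmul b (mult (lowSymbol χ ((ν : ℤ) - 1)) (mult (derivSymbol j) φ)) -
        mult (lowSymbol χ ((ν : ℤ) - 1)) (mult (derivSymbol j) (pmul b φ))) +
      mult (blockSymbol χ ν) ρ := by
    rw [hρ, map_sub (mult (blockSymbol χ ν)), mult_blockSymbol hχ ν (mult (derivSymbol j) φ),
      mult_blockSymbol hχ ν (mult (derivSymbol j) (pmul b φ)), map_sub]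
    abel
  have h2 := sNorm_commutator_low_le hχ j ν hb hL φ
  have h3 := sNorm_commutator_low_le hχ j ((ν : ℤ) - 1) hb hL φ
  have h4 : sNorm (mult (blockSymbol χ ν) ρ) ≤ L * sNorm φ := by
    refine (sNorm_mult_le' (blockSymbol_hasTemperateGrowth hχ ν) (norm_blockSymbol_le hχ ν) ρ).trans ?_
    rw [one_mul]
    exact sNorm_deriv_commutator_le j hb hL φ
  rw [h1]
  refine (sNorm_add_le _ _).trans ?_
  refine (add_le_add_left (sNorm_sub_le _ _) _).trans ?_
  linarith

/-! ### Convergence of the paraproduct -/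

theorem hasSum_distribution_apply {u : ℕ → 𝓢'(Eucl n, ℂ)} {v : 𝓢'(Eucl n, ℂ)} :
    HasSum u v ↔ ∀ φ, HasSum (fun i => u i φ) (v φ) := by
  unfold HasSum
  rw [PointwiseConvergenceCLM.tendsto_iff_forall_tendsto]
  simp

/-- Geometric decay gives convergence on each test function; the bound through the L² norm of `D φ`
makes the limit functional continuous, hence a distribution. -/
theorem summable_distribution {u : ℕ → 𝓢'(Eucl n, ℂ)} {B : ℝ}
    (D : 𝓢(Eucl n, ℂ) →L[ℂ] 𝓢(Eucl n, ℂ))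
    (h : ∀ i φ, ‖u i φ‖ ≤ B * sNorm (D φ) * (1 / 2) ^ i) : Summable u := by
  have hs : ∀ φ, Summable fun i => u i φ := fun φ =>
    Summable.of_norm_bounded (summable_geometric_two.mul_left _) fun i => h i φ
  let l : 𝓢(Eucl n, ℂ) →ₗ[ℂ] ℂ :=
    { toFun := fun φ => ∑' i, u i φ
      map_add' := fun φ ψ => by
        simp_rw [map_add]
        exact (hs φ).tsum_add (hs ψ)
      map_smul' := fun c φ => by
        simp_rw [map_smul]
        exact tsum_const_smul'' c }
  have hl : ∀ φ, ‖l φ‖ ≤ B * sNorm (D φ) * 2 := fun φ =>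
    tsum_of_norm_bounded (by simpa using hasSum_geometric_two.mul_left (B * sNorm (D φ)))
      fun i => h i φ
  have hc : Continuous l := by
    refine continuous_of_continuousAt_zero l ?_
    rw [ContinuousAt, map_zero]
    have h0 : Filter.Tendsto (fun φ => B * sNorm (D φ) * 2) (nhds 0) (nhds 0) := by
      have hc : Continuous fun φ : 𝓢(Eucl n, ℂ) => B * sNorm (D φ) * 2 :=
        (continuous_const.mul (((SchwartzMap.toLpCLM ℂ ℂ 2
          (volume : Measure (Eucl n))).continuous.comp D.continuous).norm)).mul continuous_const
      simpa [sNorm_zero] using hc.tendsto 0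
    exact squeeze_zero_norm hl h0
  refine ⟨ContinuousLinearMap.toPointwiseConvergenceCLM ℂ (RingHom.id ℂ) _ _ ⟨l, hc⟩,
    hasSum_distribution_apply.2 fun φ => (hs φ).hasSum⟩

/-- The symbol of a multiple of the Laplacian. -/
def sqSymbol (ξ : Eucl n) : ℂ := ((‖ξ‖ ^ 2 : ℝ) : ℂ)

theorem sqSymbol_hasTemperateGrowth : (sqSymbol : Eucl n → ℂ).HasTemperateGrowth := by
  unfold sqSymbol
  fun_prop

/-- Where the left side is nonzero, 2^i ≤ 7|ξ|. Squaring yields decay 4^(-i): half of it pays for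
the 2^i of Bernstein's inequality, the other half gives summability. -/
theorem norm_one_sub_symbol_le_sq (hχ : IsCutoff χ) (i : ℕ) (ξ : Eucl n) :
    ‖1 - symbol χ i ξ‖ ≤ 49 * (1 / 4) ^ i * ‖sqSymbol ξ‖ := by
  have h0 : ‖sqSymbol ξ‖ = ‖ξ‖ ^ 2 := by
    rw [sqSymbol, Complex.norm_real, Real.norm_eq_abs, abs_of_nonneg (by positivity)]
  rw [h0]
  rcases le_or_gt (2 * Real.pi * ‖ξ‖) (11 / 10 * 2 ^ (i : ℤ)) with h | h
  · rw [symbol_eq_one hχ h, sub_self, norm_zero]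
    positivity
  · refine (norm_one_sub_symbol_le hχ i ξ).trans ?_
    rw [zpow_natCast] at h
    have h1 : 2 ^ i ≤ 7 * ‖ξ‖ := by
      have := Real.pi_lt_d2
      have := norm_nonneg ξ
      have : (0 : ℝ) < 2 ^ i := by positivity
      nlinarith
    calc (1 : ℝ) = (1 / 4) ^ i * (2 ^ i) ^ 2 := by
          rw [← pow_mul, mul_comm i 2, pow_mul, ← mul_pow]
          norm_num
      _ ≤ (1 / 4) ^ i * (7 * ‖ξ‖) ^ 2 := by gcongr
      _ = _ := by ring

theorem sNorm_pmul_le {b : Eucl n → ℂ} (hb : b.HasTemperateGrowth) {C : ℝ} (h : ∀ x, ‖b x‖ ≤ C)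
    (φ : 𝓢(Eucl n, ℂ)) : sNorm (pmul b φ) ≤ C * sNorm φ := by
  apply sNorm_le_of_pointwise
  intro x
  rw [pmul_apply hb, norm_mul]
  gcongr
  exact h x

/-- By spectral separation only the part of φ at frequencies above about 2^i is seen, and this part
decays like 4^(-i). The constant is 4 · 2^3 · 49. -/
theorem norm_paraproduct_term_le (hχ : IsCutoff χ) {a : Eucl n → ℂ} (ha : Continuous a) {M : ℝ}
    (hM : ∀ x, ‖a x‖ ≤ M) (w : Lp ℂ 2 (volume : Measure (Eucl n))) (h : Fin n) (i : ℕ)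
    (φ : 𝓢(Eucl n, ℂ)) :
    ‖partialDeriv h (w : 𝓢'(Eucl n, ℂ)) (mult (blockSymbol χ (i + 3))
      (pmul (lowPassFun χ i a) φ))‖ ≤
      (1568 * ‖w‖ * (M * kernelConst n hχ)) * sNorm (mult sqSymbol φ) * (1 / 2) ^ i := by
  have hM0 : 0 ≤ M := (norm_nonneg _).trans (hM 0)
  have hσ := symbol_hasTemperateGrowth (n := n) hχ i
  have hσ' : (fun ξ : Eucl n => 1 - symbol χ i ξ).HasTemperateGrowth :=
    (Function.HasTemperateGrowth.const 1).sub hσ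
  have h1 : φ = mult (symbol χ i) φ + mult (fun ξ => 1 - symbol χ i ξ) φ := by
    apply schwartz_ext_fourier
    intro ξ
    rw [FourierTransform.fourier_add, add_apply, fourier_mult hσ, fourier_mult hσ']
    ring
  have h2 : mult (blockSymbol χ (i + 3)) (pmul (lowPassFun χ i a) φ) =
      mult (blockSymbol χ (i + 3)) (pmul (lowPassFun χ i a)
        (mult (fun ξ => 1 - symbol χ i ξ) φ)) := by
    conv_lhs => rw [h1]
    rw [map_add, map_add, mult_block_pmul_lowPass_eq_zero hχ i ha hM, zero_add]
  have h3 := sNorm_pmul_le (lowPassFun_hasTemperateGrowth hχ i ha hM) (norm_lowPassFun_le hχ i hM)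
    (mult (fun ξ => 1 - symbol χ i ξ) φ)
  have h4 := sNorm_mult_le hσ' sqSymbol_hasTemperateGrowth (norm_one_sub_symbol_le_sq hχ i) φ
  have h5 := norm_blockL2_le hχ (i + 3) w
  rw [h2]
  refine (norm_partialDeriv_mult_block_le hχ _ h w _).trans ?_
  calc _ ≤ 4 * 2 ^ (i + 3) * ‖w‖ *
        ((M * kernelConst n hχ) * (49 * (1 / 4) ^ i * sNorm (mult sqSymbol φ))) := by
        refine mul_le_mul (by gcongr) (h3.trans ?_) (norm_nonneg _) (by positivity)
        gcongr
    _ = 1568 * ‖w‖ * (M * kernelConst n hχ) * sNorm (mult sqSymbol φ) *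
        (2 ^ i * (1 / 4) ^ i) := by
        rw [pow_add]
        ring
    _ = _ := by
        rw [← mul_pow]
        norm_num

theorem lowPass_natCast_apply (hχ : IsCutoff χ) (N : ℕ) (u : 𝓢'(Eucl n, ℂ))
    (φ : 𝓢(Eucl n, ℂ)) :
    lowPass χ N u φ = ∑ k ∈ Finset.range (N + 1), u (mult (blockSymbol χ k) φ) := by
  rw [lowPass_apply hχ, ← map_sum, lowSymbol_of_nonneg (by positivity)]
  congr 1
  apply schwartz_ext_fourier
  intro ξ
  rw [FourierTransform.fourier_sum, sum_apply, fourier_mult (symbol_hasTemperateGrowth hχ N),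
    ← sum_blockSymbol, Finset.sum_mul]
  exact Finset.sum_congr rfl fun k _ => (fourier_mult (blockSymbol_hasTemperateGrowth hχ k) _ _).symm

/-- The paraproduct of a derivative of an `L²` function, as one sum over all the dyadic blocks. -/
theorem hasSum_paraproduct (hχ : IsCutoff χ) (m : ℕ) {a : Eucl n → ℂ} (ha : Continuous a) {M : ℝ}
    (hM : ∀ x, ‖a x‖ ≤ M) (w : Lp ℂ 2 (volume : Measure (Eucl n))) (h : Fin n)
    (φ : 𝓢(Eucl n, ℂ)) :
    HasSum (fun k => partialDeriv h (w : 𝓢'(Eucl n, ℂ)) (mult (blockSymbol χ k)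
        (pmul (lowPassFun χ (lowIndex m k) a) φ)))
      (paraproduct χ m a (partialDeriv h (w : 𝓢'(Eucl n, ℂ))) φ) := by
  set u := partialDeriv h (w : 𝓢'(Eucl n, ℂ)) with hu
  have hterm : ∀ i φ, TemperedDistribution.smulLeftCLM ℂ (lowPassFun χ ((m + i : ℕ) : ℤ) a)
      (block χ (m + 3 + i) u) φ = u (mult (blockSymbol χ (m + i + 3))
        (pmul (lowPassFun χ ((m + i : ℕ) : ℤ) a) φ)) := by
    intro i φ
    rw [TemperedDistribution.smulLeftCLM_apply_apply, block_apply hχ, add_right_comm m 3 i]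
  have hs : Summable fun i : ℕ => TemperedDistribution.smulLeftCLM ℂ
      (lowPassFun χ ((m + i : ℕ) : ℤ) a) (block χ (m + 3 + i) u) := by
    refine summable_distribution (B := 1568 * ‖w‖ * (M * kernelConst n hχ)) (mult sqSymbol)
      fun i φ => ?_
    have hM0 : 0 ≤ M := (norm_nonneg _).trans (hM 0)
    rw [hterm]
    refine (norm_paraproduct_term_le hχ ha hM w h (m + i) φ).trans ?_
    gcongr ?_ * ?_
    exact pow_le_pow_of_le_one (by norm_num) (by norm_num) (by omega)
  rw [paraproduct]
  have h1 := hasSum_distribution_apply.1 hs.hasSum φ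
  simp_rw [hterm] at h1
  have h2 : ∀ i, lowIndex m (i + (m + 3)) = ((m + i : ℕ) : ℤ) := fun i => by
    rw [lowIndex]
    omega
  have h3 : (fun i => u (mult (blockSymbol χ (m + i + 3))
      (pmul (lowPassFun χ ((m + i : ℕ) : ℤ) a) φ))) = fun i =>
      (fun k => u (mult (blockSymbol χ k) (pmul (lowPassFun χ (lowIndex m k) a) φ)))
        (i + (m + 3)) := by
    funext i
    simp only [h2]
    rw [show m + i + 3 = i + (m + 3) by ring]
  rw [h3] at h1
  have h1' := (hasSum_nat_add_iff (f := fun k => u (mult (blockSymbol χ k)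
    (pmul (lowPassFun χ (lowIndex m k) a) φ))) (m + 3)).1 h1
  -- The head of the series, k ≤ m + 2, must give the first term of the paraproduct: there the
  -- low-frequency index is constantly m - 1 and the blocks telescope to S_{m+2}.
  convert! h1' using 1
  rw [add_comm, add_apply, TemperedDistribution.smulLeftCLM_apply_apply]
  congr 1
  have h4 := lowPass_natCast_apply hχ (m + 2) u (pmul (lowPassFun χ ((m : ℤ) - 1) a) φ)
  push_cast at h4
  rw [h4]
  refine Finset.sum_congr rfl fun k hk => ?_
  rw [Finset.mem_range] at hk
  have : lowIndex m k = (m : ℤ) - 1 := by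
    rw [lowIndex]
    omega
  rw [this]

/-! ### The commutator as a finite sum over nearby frequencies. -/

theorem block_partialDeriv (hχ : IsCutoff χ) (ν : ℕ) (h : Fin n)
    (w : Lp ℂ 2 (volume : Measure (Eucl n))) :
    block χ ν (partialDeriv h (w : 𝓢'(Eucl n, ℂ))) =
      partialDeriv h (blockL2 hχ ν w : 𝓢'(Eucl n, ℂ)) := by
  ext φ
  rw [block_apply hχ, partialDeriv_apply, partialDeriv_apply, coe_blockL2, block_apply hχ,
    mult_comm (blockSymbol_hasTemperateGrowth hχ ν) (derivSymbol_hasTemperateGrowth h)]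

theorem commutator_apply (hχ : IsCutoff χ) (m ν : ℕ) {a : Eucl n → ℂ} (ha : Continuous a) {M : ℝ}
    (hM : ∀ x, ‖a x‖ ≤ M) (w : Lp ℂ 2 (volume : Measure (Eucl n))) (h : Fin n)
    (φ : 𝓢(Eucl n, ℂ)) :
    commutator χ ν m a (partialDeriv h (w : 𝓢'(Eucl n, ℂ))) φ =
      ∑ k ∈ Finset.Ico (ν - (m + 5)) (ν + m + 6), partialDeriv h (w : 𝓢'(Eucl n, ℂ))
        (mult (blockSymbol χ k)
          (pmul (lowPassFun χ (lowIndex m k) a) (mult (blockSymbol χ ν) φ) -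
            mult (blockSymbol χ ν) (pmul (lowPassFun χ (lowIndex m k) a) φ))) := by
  set u := partialDeriv h (w : 𝓢'(Eucl n, ℂ)) with hu
  have h1 := hasSum_paraproduct hχ m ha hM w h (mult (blockSymbol χ ν) φ)
  have h2 := hasSum_paraproduct hχ m ha hM (blockL2 hχ ν w) h φ
  rw [← block_partialDeriv, ← hu] at h2
  rw [← hu] at h1
  have h3 := h1.sub h2
  have h4 : commutator χ ν m a u φ = paraproduct χ m a u (mult (blockSymbol χ ν) φ) -
      paraproduct χ m a (block χ ν u) φ := by
    rw [← block_apply hχ, commutator, sub_apply]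
  -- Since Δ_k and Δ_ν commute, Δ_k can be made outermost in both terms, so u enters only through
  -- Δ_k u.
  have h5 : (fun k => u (mult (blockSymbol χ k) (pmul (lowPassFun χ (lowIndex m k) a)
        (mult (blockSymbol χ ν) φ))) -
      block χ ν u (mult (blockSymbol χ k) (pmul (lowPassFun χ (lowIndex m k) a) φ))) =
      fun k => u (mult (blockSymbol χ k)
        (pmul (lowPassFun χ (lowIndex m k) a) (mult (blockSymbol χ ν) φ) -
          mult (blockSymbol χ ν) (pmul (lowPassFun χ (lowIndex m k) a) φ))) := by
    funext k
    rw [block_apply hχ, mult_comm (blockSymbol_hasTemperateGrowth hχ ν)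
      (blockSymbol_hasTemperateGrowth hχ k), map_sub (mult (blockSymbol χ k)), map_sub u]
  rw [h5, ← h4] at h3
  -- Outside the window each of the two terms vanishes separately. Truncated subtraction in the
  -- lower endpoint just starts the window at 0.
  refine h3.unique (hasSum_sum_of_ne_finset_zero fun k hk => ?_)
  rw [Finset.mem_Ico] at hk
  rw [map_sub (mult (blockSymbol χ k)), mult_block_pmul_block_eq_zero hχ ha hM (by omega),
    mult_block_mult_block_eq_zero hχ (by omega), sub_self, map_zero]

/-- The commutator estimate for a single dyadic block. -/
theorem l2Norm_partialDeriv_commutator_le (hχ : IsCutoff χ) (m ν : ℕ) {a : Eucl n → ℂ} {M : ℝ}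
    (hM : ∀ x, ‖a x‖ ≤ M) {L : ℝ≥0} (hL : LipschitzWith L a)
    (w : Lp ℂ 2 (volume : Measure (Eucl n))) (j h : Fin n) :
    l2Norm (partialDeriv j (commutator χ ν m a (partialDeriv h (w : 𝓢'(Eucl n, ℂ))))) ≤
      ENNReal.ofReal (4 * kernelConst n hχ * (2 * commConst hχ j + 1) * L *
        ∑ k ∈ Finset.Ico (ν - (m + 5)) (ν + m + 6), 2 ^ k * ‖blockL2 hχ k w‖) := by
  have hC := commConst_nonneg hχ j
  apply l2Norm_le_of_bound _ (by positivity)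
  intro φ
  rw [partialDeriv_apply, norm_neg, commutator_apply hχ m ν hL.continuous hM, Finset.mul_sum,
    Finset.sum_mul]
  refine (norm_sum_le _ _).trans (Finset.sum_le_sum fun k _ => ?_)
  refine (norm_partialDeriv_mult_block_le hχ k h w _).trans ?_
  have h1 := sNorm_block_commutator_le hχ j ν
    (lowPassFun_hasTemperateGrowth hχ (lowIndex m k) hL.continuous hM)
    (lipschitzWith_lowPassFun hχ (lowIndex m k) hM hL) φ
  refine (mul_le_mul_of_nonneg_left h1 (by positivity)).trans_eq ?_
  rw [NNReal.coe_mul]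
  ring

/-! ### Summation over the dyadic blocks -/

/-- The relation |k - ν| ≤ p is symmetric, so after exchanging sums each k is counted at most 2p + 1
times. -/
theorem tsum_window_le (y : ℕ → ℝ≥0∞) (p : ℕ) :
    ∑' ν : ℕ, ∑ k ∈ Finset.Ico (ν - p) (ν + p + 1), y k ≤ (2 * p + 1 : ℕ) * ∑' k, y k := by
  have h1 : ∀ ν : ℕ, ∑ k ∈ Finset.Ico (ν - p) (ν + p + 1), y k =
      ∑' k, if k ∈ Finset.Ico (ν - p) (ν + p + 1) then y k else 0 := fun ν => by
    rw [tsum_eq_sum (s := Finset.Ico (ν - p) (ν + p + 1)) fun k hk => if_neg hk]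
    exact Finset.sum_congr rfl fun k hk => (if_pos hk).symm
  simp_rw [h1]
  rw [ENNReal.tsum_comm, ← ENNReal.tsum_mul_left]
  refine ENNReal.tsum_le_tsum fun k => ?_
  rw [tsum_eq_sum (s := Finset.Ico (k - p) (k + p + 1)) fun ν hν => if_neg (by
    rw [Finset.mem_Ico] at hν ⊢
    omega)]
  refine (Finset.sum_le_card_nsmul _ _ (y k) fun ν _ => by split_ifs <;> simp).trans ?_
  rw [nsmul_eq_mul, Nat.card_Ico]
  gcongr
  omega

/-- Cauchy–Schwarz costs the number of terms, at most 2p + 1. Replacing ν by k in the weight costs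
2^(2σ(k-ν)) ≤ 2^(2p), as 0 ≤ σ ≤ 1. -/
theorem weighted_sq_window_le {σ : ℝ} (hσ0 : 0 ≤ σ) (hσ1 : σ ≤ 1) (x : ℕ → ℝ) (p ν : ℕ) :
    (2 : ℝ) ^ (-2 * σ * (ν : ℝ)) * (∑ k ∈ Finset.Ico (ν - p) (ν + p + 1), x k) ^ 2 ≤
      (2 * p + 1) * 2 ^ (2 * p) *
        ∑ k ∈ Finset.Ico (ν - p) (ν + p + 1), (2 : ℝ) ^ (-2 * σ * (k : ℝ)) * x k ^ 2 := by
  have h1 := sq_sum_le_card_mul_sum_sq (s := Finset.Ico (ν - p) (ν + p + 1)) (f := x)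
  have h2 : ((Finset.Ico (ν - p) (ν + p + 1)).card : ℝ) ≤ 2 * p + 1 := by
    rw [Nat.card_Ico]
    exact_mod_cast (by omega : ν + p + 1 - (ν - p) ≤ 2 * p + 1)
  calc _ ≤ (2 : ℝ) ^ (-2 * σ * (ν : ℝ)) *
        ((2 * p + 1) * ∑ k ∈ Finset.Ico (ν - p) (ν + p + 1), x k ^ 2) := by
        gcongr
        refine h1.trans ?_
        gcongr
    _ = (2 * p + 1) * ∑ k ∈ Finset.Ico (ν - p) (ν + p + 1),
        (2 : ℝ) ^ (-2 * σ * (ν : ℝ)) * x k ^ 2 := by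
        rw [← Finset.mul_sum]
        ring
    _ ≤ (2 * p + 1) * ∑ k ∈ Finset.Ico (ν - p) (ν + p + 1),
        2 ^ (2 * p) * ((2 : ℝ) ^ (-2 * σ * (k : ℝ)) * x k ^ 2) := by
        refine mul_le_mul_of_nonneg_left (Finset.sum_le_sum fun k hk => ?_) (by positivity)
        rw [← mul_assoc]
        refine mul_le_mul_of_nonneg_right ?_ (sq_nonneg _)
        rw [← Real.rpow_natCast, ← Real.rpow_add two_pos]
        apply Real.rpow_le_rpow_of_exponent_le one_le_two
        rw [Finset.mem_Ico] at hk
        have h3 : (k : ℝ) ≤ ν + p := by exact_mod_cast (by omega : k ≤ ν + p)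
        have h4 : σ * (k - ν) ≤ σ * p := mul_le_mul_of_nonneg_left (by linarith) hσ0
        have h5 : σ * p ≤ 1 * p := mul_le_mul_of_nonneg_right hσ1 (Nat.cast_nonneg p)
        push_cast
        nlinarith
    _ = _ := by
        rw [← Finset.mul_sum]
        ring

theorem weighted_l2Norm_block (hχ : IsCutoff χ) (σ : ℝ) (k : ℕ)
    (w : Lp ℂ 2 (volume : Measure (Eucl n))) :
    ENNReal.ofReal ((2 : ℝ) ^ (2 * (k : ℝ))) *
        l2Norm ((((2 : ℝ) ^ (-σ * (k : ℝ)) : ℝ) : ℂ) • block χ k (w : 𝓢'(Eucl n, ℂ))) ^ 2 =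
      ENNReal.ofReal ((2 : ℝ) ^ (-2 * σ * (k : ℝ)) * (2 ^ k * ‖blockL2 hχ k w‖) ^ 2) := by
  rw [l2Norm_smul_block hχ k w (by positivity), ← ENNReal.ofReal_pow (by positivity),
    ← ENNReal.ofReal_mul (by positivity), mul_pow, mul_pow, ← mul_assoc, ← mul_assoc,
    mul_comm ((2 : ℝ) ^ (2 * (k : ℝ)))]
  congr 3
  · rw [← Real.rpow_natCast, ← Real.rpow_mul zero_le_two]
    congr 1
    push_cast
    ring
  · rw [mul_comm (2 : ℝ), Real.rpow_mul zero_le_two, Real.rpow_natCast, Real.rpow_two]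

/-- With p = m + 5, one factor 2p + 1 comes from Cauchy–Schwarz inside a window and the other from
the overlap of windows. Working in `ℝ≥0∞` allows a divergent right-hand side. -/
theorem tsum_commutator_le (hχ : IsCutoff χ) (m : ℕ) {a : Eucl n → ℂ} {M : ℝ}
    (hM : ∀ x, ‖a x‖ ≤ M) {L : ℝ≥0} (hL : LipschitzWith L a) {σ : ℝ} (hσ0 : 0 ≤ σ) (hσ1 : σ ≤ 1)
    (w : Lp ℂ 2 (volume : Measure (Eucl n))) (j h : Fin n) :
    ∑' ν : ℕ, ENNReal.ofReal ((2 : ℝ) ^ (-2 * σ * (ν : ℝ))) * l2Norm (partialDeriv j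
        (commutator χ ν m a (partialDeriv h (w : 𝓢'(Eucl n, ℂ))))) ^ 2 ≤
      ENNReal.ofReal ((4 * kernelConst n hχ * (2 * commConst hχ j + 1)) ^ 2 *
        (2 * (m + 5 : ℕ) + 1) ^ 2 * 2 ^ (2 * (m + 5)) * (L : ℝ) ^ 2) *
      ∑' ν : ℕ, ENNReal.ofReal ((2 : ℝ) ^ (2 * (ν : ℝ))) *
        l2Norm ((((2 : ℝ) ^ (-σ * (ν : ℝ)) : ℝ) : ℂ) • block χ ν (w : 𝓢'(Eucl n, ℂ))) ^ 2 := by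
  simp_rw [weighted_l2Norm_block hχ]
  set A : ℝ := 4 * kernelConst n hχ * (2 * commConst hχ j + 1) with hA
  set p := m + 5 with hp
  set x : ℕ → ℝ := fun k => 2 ^ k * ‖blockL2 hχ k w‖ with hx
  have hA0 : 0 ≤ A := by
    have := commConst_nonneg hχ j
    positivity
  have h1 : ∀ ν : ℕ, ENNReal.ofReal ((2 : ℝ) ^ (-2 * σ * (ν : ℝ))) * l2Norm (partialDeriv j
        (commutator χ ν m a (partialDeriv h (w : 𝓢'(Eucl n, ℂ))))) ^ 2 ≤
      ENNReal.ofReal ((A * L) ^ 2 * ((2 * p + 1) * 2 ^ (2 * p))) *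
        ∑ k ∈ Finset.Ico (ν - p) (ν + p + 1),
          ENNReal.ofReal ((2 : ℝ) ^ (-2 * σ * (k : ℝ)) * x k ^ 2) := by
    intro ν
    have h2 := l2Norm_partialDeriv_commutator_le hχ m ν hM hL w j h
    have hs : 0 ≤ ∑ k ∈ Finset.Ico (ν - p) (ν + p + 1), x k :=
      Finset.sum_nonneg fun k _ => by positivity
    calc _ ≤ ENNReal.ofReal ((2 : ℝ) ^ (-2 * σ * (ν : ℝ))) *
          ENNReal.ofReal (A * L * ∑ k ∈ Finset.Ico (ν - p) (ν + p + 1), x k) ^ 2 := by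
          gcongr
          exact h2
      _ = ENNReal.ofReal ((A * L) ^ 2 * ((2 : ℝ) ^ (-2 * σ * (ν : ℝ)) *
          (∑ k ∈ Finset.Ico (ν - p) (ν + p + 1), x k) ^ 2)) := by
          rw [← ENNReal.ofReal_pow (by positivity), ← ENNReal.ofReal_mul (by positivity)]
          congr 1
          ring
      _ ≤ ENNReal.ofReal ((A * L) ^ 2 * ((2 * p + 1) * 2 ^ (2 * p) *
          ∑ k ∈ Finset.Ico (ν - p) (ν + p + 1), (2 : ℝ) ^ (-2 * σ * (k : ℝ)) * x k ^ 2)) := by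
          exact ENNReal.ofReal_le_ofReal (mul_le_mul_of_nonneg_left
            (weighted_sq_window_le hσ0 hσ1 x p ν) (by positivity))
      _ = _ := by
          rw [← mul_assoc, ENNReal.ofReal_mul (by positivity),
            ENNReal.ofReal_sum_of_nonneg fun k _ => by positivity]
  refine (ENNReal.tsum_le_tsum h1).trans ?_
  rw [ENNReal.tsum_mul_left]
  refine (mul_le_mul_right (tsum_window_le _ p) _).trans_eq ?_
  rw [← mul_assoc, ← ENNReal.ofReal_natCast, ← ENNReal.ofReal_mul (by positivity)]
  congr 2
  push_cast
  ring

end LittlewoodPaley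

end

/-! ### Choice of the constant and conclusion. -/

theorem mainTheorem5 (n : ℕ) (χ : ℝ → ℝ) (hχ : LittlewoodPaley.IsCutoff χ) (m : ℕ) :
    ∃ C : ℝ, 0 < C ∧
      ∀ (a : LittlewoodPaley.Eucl n → ℂ),
        (∃ M : ℝ, ∀ x, ‖a x‖ ≤ M) → (∃ K : ℝ≥0, LipschitzWith K a) →
      ∀ (s α T t : ℝ), 0 < s → s < 1 → 0 < α → 0 < T → 0 ≤ t → t < T →
        t ≤ 7 / 8 * ((1 - s) / α) →
      ∀ w : ℝ → Lp ℂ 2 (volume : Measure (LittlewoodPaley.Eucl n)),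
        LittlewoodPaley.MemSolutionSpace T w →
      ∀ j h : Fin n,
        ∑' ν : ℕ, ENNReal.ofReal ((2 : ℝ) ^ (-2 * (s + α * t) * (ν : ℝ))) *
            LittlewoodPaley.l2Norm (LittlewoodPaley.partialDeriv j
              (LittlewoodPaley.commutator χ ν m a
                (LittlewoodPaley.partialDeriv h
                  (w t : 𝓢'(LittlewoodPaley.Eucl n, ℂ))))) ^ 2
          ≤ ENNReal.ofReal (C / (1 - s) * (LittlewoodPaley.lipNorm a : ℝ) ^ 2) *
            ∑' ν : ℕ, ENNReal.ofReal ((2 : ℝ) ^ (2 * (ν : ℝ))) *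
              LittlewoodPaley.l2Norm
                ((((2 : ℝ) ^ (-(s + α * t) * (ν : ℝ)) : ℝ) : ℂ) •
                  LittlewoodPaley.block χ ν
                    (w t : 𝓢'(LittlewoodPaley.Eucl n, ℂ))) ^ 2 := by
  let B : Fin n → ℝ := fun j => (4 * LittlewoodPaley.kernelConst n hχ *
    (2 * LittlewoodPaley.commConst hχ j + 1)) ^ 2 * (2 * (m + 5 : ℕ) + 1) ^ 2 * 2 ^ (2 * (m + 5))
  have hB : ∀ j, 0 ≤ B j := fun j => by positivity
  have hS : 0 ≤ ∑ j, B j := Finset.sum_nonneg fun j _ => hB j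
  -- Summing over j removes the dependence on the direction; adding 1 ensures positivity, even for n
  -- = 0.
  refine ⟨∑ j, B j + 1, by positivity, ?_⟩
  rintro a ⟨M, hM⟩ hLip s α T t hs0 hs1 hα hT ht0 htT ht w - j h
  -- This puts σ = s + αt in [0, 1], the range in which the weights are comparable.
  have hαt : α * t ≤ 7 / 8 * (1 - s) := by
    calc α * t ≤ α * (7 / 8 * ((1 - s) / α)) := by gcongr
      _ = 7 / 8 * (1 - s) := by field_simp
  have hαt0 : 0 ≤ α * t := by positivity
  refine (LittlewoodPaley.tsum_commutator_le hχ m hM (LittlewoodPaley.lipschitzWith_lipNorm hLip)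
    (σ := s + α * t) (by linarith) (by linarith) (w t) j h).trans ?_
  gcongr ENNReal.ofReal (?_ * _) * _
  have h1 : B j ≤ ∑ j, B j := Finset.single_le_sum (fun i _ => hB i) (Finset.mem_univ j)
  rw [le_div_iff₀ (by linarith)]
  calc B j * (1 - s) ≤ B j * 1 := by
        gcongr
        linarith
    _ ≤ ∑ j, B j + 1 := by linarith
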